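/- Let $d\ge 1$, $1<p<+\infty$, let $\Omega\subset\mathbb R^d$ be a bounded open set, and endow $W^{1,p}_0(\Omega)$ (the closure of $C^\infty_c(\Omega)$ in $W^{1,p}(\Omega)$) with the norm $\|u\|_{1,p}=\bigl(\int_\Omega|\nabla u|^p\,dx\bigr)^{1/p}$. For $A\subset\Omega$ let $$C_{1,p}(A)=\inf\Bigl\{\int_\Omega|\nabla u|^p\,dx:\ u\in W^{1,p}_0(\Omega),\ u\ge 1 \text{ a.e. in a neighbourhood of } A\Bigr\}$$ (with $\inf\emptyset=+\infty$). A function $f\colon\Omega\to\mathbb R$ is quasicontinuous if for every $\varepsilon>0$ there is an open set $U\subset\Omega$ with $C_{1,p}(U)<\varepsilon$ such that the restriction of $f$ to $\Omega\setminus U$ is continuous; a Borel quasicontinuous representative of $u\in W^{1,p}_0(\Omega)$ is a Borel measurable quasicontinuous function $\widetilde u\colon\Omega\to\mathbb R$ with $\widetilde u=u$ a.e. in $\Omega$. For a signed Radon measure $\mu$ on $\Omega\times\Omega$ (not necessarily of finite total variation), with total variation measure $|\mu|$, the Sobolev cut norm is $$\|\mu\|_\square=\sup\Bigl\{\Bigl|\int_{\Omega\times\Omega}\varphi(x)\psi(y)\,d\mu(x,y)\Bigr|:\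 \varphi,\psi\in C^\infty_c(\Omega),\ \|\varphi\|_{1,p}\le1,\ \|\psi\|_{1,p}\le 1\Bigr\}.$$ Theorem. Let $\mu$ be a signed Radon measure on $\Omega\times\Omega$ with $\|\mu\|_\square<+\infty$. Then for every $A\subset\Omega$ with $C_{1,p}(A)=0$ the sets $A\times\Omega$ and $\Omega\times A$ are $|\mu|$-measurable and $$|\mu|(A\times\Omega)=|\mu|(\Omega\times A)=0.$$ Moreover, let $u,v\in W^{1,p}_0(\Omega)\cap L^\infty(\Omega)$ have compact support in $\Omega$. Then for all Borel quasicontinuous representatives $\widetilde u$ of $u$ and $\widetilde v$ of $v$ the function $(x,y)\mapsto\widetilde u(x)\widetilde v(y)$ is $|\mu|$-integrable and $$\Bigl|\int_{\Omega\times\Omega}\widetilde u(x)\widetilde v(y)\,d\mu(x,y)\Bigr|\le\|\mu\|_\square\,\|u\|_{1,p}\,\|v\|_{1,p},$$ and the value of the integral does not depend on the choice of the representatives $\widetilde u,\widetilde v$. -/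

import Mathlib

open MeasureTheory Filter Topology TopologicalSpace
open scoped ENNReal Distributions

namespace SobolevCut

noncomputable section

/-- A signed Radon measure on a subset `U` (in practice an open set) of a topological space `X`,
given by its Jordan decomposition: two mutually singular positive Borel measures, carried by `U`
and finite on the compact subsets of `U`. The two parts may both have infinite total mass. On an
open subset `U` of a Euclidean space these are exactly the elements of the dual of `C_c(U)`. -/
structure SignedRadonMeasure {X : Type*} [TopologicalSpace X] [MeasurableSpace X]
    (U : Set X) where
  /-- positive part -/
  pos : Measure X
  /-- negative part -/
  neg : Measure X
  pos_compl : pos Uᶜ = 0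
  neg_compl : neg Uᶜ = 0
  pos_lt_top : ∀ K : Set X, IsCompact K → K ⊆ U → pos K < ⊤
  neg_lt_top : ∀ K : Set X, IsCompact K → K ⊆ U → neg K < ⊤
  mutuallySingular : pos ⟂ₘ neg

/-- The total variation measure `|μ| = μ⁺ + μ⁻`. -/
def SignedRadonMeasure.totalVariation {X : Type*} [TopologicalSpace X] [MeasurableSpace X]
    {U : Set X} (μ : SignedRadonMeasure U) : Measure X :=
  μ.pos + μ.neg

/-- The integral `∫ f dμ = ∫ f dμ⁺ - ∫ f dμ⁻` (meaningful for `f ∈ L¹(|μ|)`). -/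
def SignedRadonMeasure.integral {X : Type*} [TopologicalSpace X] [MeasurableSpace X]
    {U : Set X} (μ : SignedRadonMeasure U) (f : X → ℝ) : ℝ :=
  ∫ z, f z ∂μ.pos - ∫ z, f z ∂μ.neg

/-- `G` is a weak (distributional) gradient of `u` on the open set `Ω`. Only the values on `Ω`
matter. -/
def HasWeakGradient {d : ℕ} (Ω : Opens (EuclideanSpace ℝ (Fin d)))
    (u : EuclideanSpace ℝ (Fin d) → ℝ)
    (G : EuclideanSpace ℝ (Fin d) → EuclideanSpace ℝ (Fin d)) : Prop :=
  LocallyIntegrableOn u Ω ∧ LocallyIntegrableOn G Ω ∧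
    ∀ (φ : 𝓓(Ω, ℝ)) (v : EuclideanSpace ℝ (Fin d)),
      ∫ x in (Ω : Set (EuclideanSpace ℝ (Fin d))), u x * fderiv ℝ φ x v =
        -∫ x in (Ω : Set (EuclideanSpace ℝ (Fin d))), inner ℝ (G x) v * φ x

open Classical in
/-- The weak gradient of `u` on `Ω` (unique almost everywhere in `Ω` when it exists; `0` when
there is none). -/
def weakGradient {d : ℕ} (Ω : Opens (EuclideanSpace ℝ (Fin d)))
    (u : EuclideanSpace ℝ (Fin d) → ℝ) :
    EuclideanSpace ℝ (Fin d) → EuclideanSpace ℝ (Fin d) :=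
  if h : ∃ G, HasWeakGradient Ω u G then h.choose else 0

/-- The Sobolev space `W^{1,p}(Ω)`. -/
def MemW1p {d : ℕ} (p : ℝ) (Ω : Opens (EuclideanSpace ℝ (Fin d)))
    (u : EuclideanSpace ℝ (Fin d) → ℝ) : Prop :=
  MemLp u (ENNReal.ofReal p) (volume.restrict Ω) ∧
    ∃ G, HasWeakGradient Ω u G ∧ MemLp G (ENNReal.ofReal p) (volume.restrict Ω)

/-- The Sobolev space `W^{1,p}_0(Ω)`: the closure of `C^∞_c(Ω)` in `W^{1,p}(Ω)`. -/
def MemW1pZero {d : ℕ} (p : ℝ) (Ω : Opens (EuclideanSpace ℝ (Fin d)))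
    (u : EuclideanSpace ℝ (Fin d) → ℝ) : Prop :=
  MemW1p p Ω u ∧ ∃ φ : ℕ → 𝓓(Ω, ℝ),
    Tendsto (fun n => eLpNorm (fun x => u x - φ n x) (ENNReal.ofReal p) (volume.restrict Ω))
      atTop (𝓝 0) ∧
    Tendsto (fun n => eLpNorm (fun x => weakGradient Ω u x - gradient (φ n) x)
      (ENNReal.ofReal p) (volume.restrict Ω)) atTop (𝓝 0)

/-- The norm `‖u‖_{1,p} = (∫_Ω |∇u|^p dx)^{1/p}` of `W^{1,p}_0(Ω)`. -/
def sobolevNorm {d : ℕ} (p : ℝ) (Ω : Opens (EuclideanSpace ℝ (Fin d)))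
    (u : EuclideanSpace ℝ (Fin d) → ℝ) : ℝ :=
  (∫ x in (Ω : Set (EuclideanSpace ℝ (Fin d))), ‖weakGradient Ω u x‖ ^ p) ^ (1 / p)

/-- `u` has compact support in `Ω` (in the almost everywhere sense). -/
def HasCompactSupportIn {d : ℕ} (Ω : Opens (EuclideanSpace ℝ (Fin d)))
    (u : EuclideanSpace ℝ (Fin d) → ℝ) : Prop :=
  ∃ K : Set (EuclideanSpace ℝ (Fin d)), IsCompact K ∧ K ⊆ Ω ∧
    ∀ᵐ x ∂volume.restrict (Ω : Set (EuclideanSpace ℝ (Fin d))), x ∉ K → u x = 0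

/-- The capacity `C_{1,p}(A)` in `Ω` of a set `A ⊆ Ω`: the infimum of `∫_Ω |∇u|^p dx` over all
`u ∈ W^{1,p}_0(Ω)` with `u ≥ 1` almost everywhere in an (open) neighbourhood of `A`; it is `⊤` if
there is no such `u`. -/
def capacity {d : ℕ} (p : ℝ) (Ω : Opens (EuclideanSpace ℝ (Fin d)))
    (A : Set (EuclideanSpace ℝ (Fin d))) : ℝ≥0∞ :=
  ⨅ (u : EuclideanSpace ℝ (Fin d) → ℝ) (_ : MemW1pZero p Ω u ∧
      ∃ U : Set (EuclideanSpace ℝ (Fin d)), IsOpen U ∧ A ⊆ U ∧ U ⊆ Ω ∧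
        ∀ᵐ x ∂volume.restrict U, 1 ≤ u x),
    ∫⁻ x in (Ω : Set (EuclideanSpace ℝ (Fin d))), ‖weakGradient Ω u x‖ₑ ^ p

/-- Quasicontinuity on `Ω`: continuity of the restriction to the complement in `Ω` of open sets of
arbitrarily small capacity. -/
def Quasicontinuous {d : ℕ} (p : ℝ) (Ω : Opens (EuclideanSpace ℝ (Fin d)))
    (f : EuclideanSpace ℝ (Fin d) → ℝ) : Prop :=
  ∀ ε : ℝ≥0∞, 0 < ε → ∃ U : Set (EuclideanSpace ℝ (Fin d)), IsOpen U ∧ U ⊆ Ω ∧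
    capacity p Ω U < ε ∧ ContinuousOn f (Ω \ U)

/-- `f` (restricted to `Ω`) is a Borel quasicontinuous representative of `u`. -/
def IsQuasicontinuousRep {d : ℕ} (p : ℝ) (Ω : Opens (EuclideanSpace ℝ (Fin d)))
    (u f : EuclideanSpace ℝ (Fin d) → ℝ) : Prop :=
  Measurable ((Ω : Set (EuclideanSpace ℝ (Fin d))).domRestrict f) ∧ Quasicontinuous p Ω f ∧
    f =ᵐ[volume.restrict (Ω : Set (EuclideanSpace ℝ (Fin d)))] u

/-- The Sobolev cut norm `‖μ‖_□` (possibly `⊤`) of a signed Radon measure on `Ω × Ω`. -/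
def cutNorm {d : ℕ} (p : ℝ) (Ω : Opens (EuclideanSpace ℝ (Fin d)))
    (μ : SignedRadonMeasure
      ((Ω : Set (EuclideanSpace ℝ (Fin d))) ×ˢ (Ω : Set (EuclideanSpace ℝ (Fin d))))) : ℝ≥0∞ :=
  ⨆ (φ : 𝓓(Ω, ℝ)) (ψ : 𝓓(Ω, ℝ)) (_ : sobolevNorm p Ω φ ≤ 1) (_ : sobolevNorm p Ω ψ ≤ 1),
    ENNReal.ofReal |μ.integral fun z => φ z.1 * ψ z.2|

end

end SobolevCut

/-! The cut norm controls only the signed measure, yet it forbids `|μ|` to charge `A × Ω` when `A`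
has capacity zero. Let `K` be compact of capacity zero and `L` compact. Take cutoffs `ψ_n`
converging pointwise to the indicator of `L`, and then test functions `0 ≤ φ_n ≤ 1`, equal to 1 on
`K` and converging pointwise to its indicator, with Sobolev norm so small that `‖φ_n‖ ‖ψ_n‖ → 0`
(`exists_small_test`). Then `∫ φ_n ψ_n dμ → 0`, while dominated convergence gives the limit `μ⁺(K ×
L) - μ⁻(K × L)`. So the two parts agree on these rectangles (`IsCutPair.measure_prod_compact_eq`).
By inner regularity they agree on Borel rectangles, hence as measures on pieces of `N × Ω` with `N`
Borel of capacity zero. Being mutually singular, they vanish there. A general `A` sits inside a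
Borel set of capacity zero, and the other factor follows by swapping coordinates.

For the integral inequality, `u` and `v` are approximated by test functions with a common sup bound
and a common compact support (`exists_bounded_approx`). Subsequences converge quasi-everywhere to
the given representatives (`IsSobolevLimit.exists_subseq_quasi_tendsto`), so by the first half the
products converge `|μ|`-almost everywhere. Dominated convergence transfers both the integral and the
bound.

Quasi-everywhere convergence rests on countable subadditivity of the capacity (`capacity_iUnion_le`,
via Poincaré's inequality), on a Chebyshev-type estimate for differences of test functions, and on
the fact that quasicontinuous functions equal almost everywhere are equal quasi-everywhere
(`Quasicontinuous.capacity_ne_eq_zero`). The last fact also gives independence of the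
representatives.

Absolute values and minima of Sobolev functions are avoided throughout: composition with a smooth
step or a smooth truncation takes their place. -/

namespace SobolevCut

variable {d : ℕ} {p : ℝ} {Ω : Opens (EuclideanSpace ℝ (Fin d))}

/-! ### Calculus of test functions and integration by parts -/

section TestFunctions

/-- Composition of a test function with a smooth function vanishing at the origin. -/
noncomputable def smoothComp (φ : 𝓓(Ω, ℝ)) (T : ℝ → ℝ) (hT : ContDiff ℝ ((⊤ : ℕ∞) : WithTop ℕ∞) T)
    (h0 : T 0 = 0) : 𝓓(Ω, ℝ) where
  toFun x := T (φ x)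
  contDiff' := hT.comp φ.contDiff
  hasCompactSupport' := φ.hasCompactSupport.comp_left h0
  tsupport_subset' := (tsupport_comp_subset h0 φ).trans φ.tsupport_subset

@[simp] theorem smoothComp_apply (φ : 𝓓(Ω, ℝ)) (T : ℝ → ℝ)
    (hT : ContDiff ℝ ((⊤ : ℕ∞) : WithTop ℕ∞) T) (h0 : T 0 = 0)
    (x : EuclideanSpace ℝ (Fin d)) : smoothComp φ T hT h0 x = T (φ x) := rfl

/-- The product of two test functions. -/
noncomputable def mulTest (χ φ : 𝓓(Ω, ℝ)) : 𝓓(Ω, ℝ) where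
  toFun x := χ x * φ x
  contDiff' := χ.contDiff.mul φ.contDiff
  hasCompactSupport' := φ.hasCompactSupport.mul_left
  tsupport_subset' := (tsupport_mul_subset_right).trans φ.tsupport_subset

@[simp] theorem mulTest_apply (χ φ : 𝓓(Ω, ℝ)) (x : EuclideanSpace ℝ (Fin d)) :
    mulTest χ φ x = χ x * φ x := rfl

theorem test_differentiable (φ : 𝓓(Ω, ℝ)) : Differentiable ℝ φ :=
  φ.contDiff.differentiable (by simp)

theorem gradient_norm (f : EuclideanSpace ℝ (Fin d) → ℝ) (x : EuclideanSpace ℝ (Fin d)) :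
    ‖gradient f x‖ = ‖fderiv ℝ f x‖ := by
  rw [← toDual_gradient, LinearIsometryEquiv.norm_map]

theorem gradient_add_test (φ ψ : 𝓓(Ω, ℝ)) (x : EuclideanSpace ℝ (Fin d)) :
    gradient (φ + ψ : 𝓓(Ω, ℝ)) x = gradient φ x + gradient ψ x := by
  have : ((φ + ψ : 𝓓(Ω, ℝ)) : EuclideanSpace ℝ (Fin d) → ℝ) = (φ : _ → ℝ) + (ψ : _ → ℝ) := by
    ext; simp
  rw [this]
  simp only [gradient]
  rw [fderiv_add (test_differentiable φ x) (test_differentiable ψ x), map_add]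

theorem gradient_sub_test (φ ψ : 𝓓(Ω, ℝ)) (x : EuclideanSpace ℝ (Fin d)) :
    gradient (φ - ψ : 𝓓(Ω, ℝ)) x = gradient φ x - gradient ψ x := by
  have : ((φ - ψ : 𝓓(Ω, ℝ)) : EuclideanSpace ℝ (Fin d) → ℝ) = (φ : _ → ℝ) - (ψ : _ → ℝ) := by
    ext; simp
  rw [this]
  simp only [gradient]
  rw [fderiv_sub (test_differentiable φ x) (test_differentiable ψ x), map_sub]

theorem gradient_smul_test (c : ℝ) (φ : 𝓓(Ω, ℝ)) (x : EuclideanSpace ℝ (Fin d)) :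
    gradient (c • φ : 𝓓(Ω, ℝ)) x = c • gradient φ x := by
  have : ((c • φ : 𝓓(Ω, ℝ)) : EuclideanSpace ℝ (Fin d) → ℝ) = c • (φ : _ → ℝ) := by
    ext; simp
  rw [this]
  simp only [gradient]
  rw [fderiv_const_smul (test_differentiable φ x), map_smul]

theorem gradient_zero_test (x : EuclideanSpace ℝ (Fin d)) :
    gradient (0 : 𝓓(Ω, ℝ)) x = 0 := by
  have : ((0 : 𝓓(Ω, ℝ)) : EuclideanSpace ℝ (Fin d) → ℝ) = fun _ => 0 := by ext; simp
  rw [this]; simp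

theorem gradient_mulTest (χ φ : 𝓓(Ω, ℝ)) (x : EuclideanSpace ℝ (Fin d)) :
    gradient (mulTest χ φ) x = χ x • gradient φ x + φ x • gradient χ x := by
  have : (mulTest χ φ : EuclideanSpace ℝ (Fin d) → ℝ) = fun y => χ y * φ y := rfl
  rw [this]
  simp only [gradient]
  rw [fderiv_fun_mul (test_differentiable χ x) (test_differentiable φ x), map_add, map_smul,
    map_smul]

theorem gradient_smoothComp (φ : 𝓓(Ω, ℝ)) (T : ℝ → ℝ)
    (hT : ContDiff ℝ ((⊤ : ℕ∞) : WithTop ℕ∞) T) (h0 : T 0 = 0)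
    (x : EuclideanSpace ℝ (Fin d)) :
    gradient (smoothComp φ T hT h0) x = deriv T (φ x) • gradient φ x := by
  have h1 : (smoothComp φ T hT h0 : EuclideanSpace ℝ (Fin d) → ℝ) = T ∘ φ := rfl
  have hd : DifferentiableAt ℝ T (φ x) := hT.differentiable (by simp) _
  rw [h1]
  simp only [gradient]
  rw [(hd.hasDerivAt.comp_hasFDerivAt x (test_differentiable φ x).hasFDerivAt).fderiv, map_smul]

theorem gradient_continuous (φ : 𝓓(Ω, ℝ)) : Continuous (gradient φ) := by
  have : Continuous (fderiv ℝ φ) := φ.contDiff.continuous_fderiv (by simp)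
  unfold gradient
  exact (LinearIsometryEquiv.continuous _).comp this

theorem gradient_hasCompactSupport (φ : 𝓓(Ω, ℝ)) : HasCompactSupport (gradient φ) := by
  have := φ.hasCompactSupport.fderiv (𝕜 := ℝ)
  exact this.comp_left (g := (InnerProductSpace.toDual ℝ (EuclideanSpace ℝ (Fin d))).symm)
    (map_zero _)

theorem test_memLp (φ : 𝓓(Ω, ℝ)) (q : ℝ≥0∞) :
    MemLp φ q (volume.restrict (Ω : Set (EuclideanSpace ℝ (Fin d)))) :=
  (φ.continuous.memLp_of_hasCompactSupport φ.hasCompactSupport).restrict _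

theorem gradient_memLp (φ : 𝓓(Ω, ℝ)) (q : ℝ≥0∞) :
    MemLp (gradient φ) q (volume.restrict (Ω : Set (EuclideanSpace ℝ (Fin d)))) :=
  ((gradient_continuous φ).memLp_of_hasCompactSupport (gradient_hasCompactSupport φ)).restrict _

theorem test_bounded (φ : 𝓓(Ω, ℝ)) : ∃ C, 0 ≤ C ∧ ∀ x, |φ x| ≤ C := by
  obtain ⟨C, hC⟩ := φ.continuous.bounded_above_of_compact_support φ.hasCompactSupport
  exact ⟨C, (norm_nonneg _).trans (hC 0), hC⟩

theorem gradient_bounded (φ : 𝓓(Ω, ℝ)) : ∃ C, 0 ≤ C ∧ ∀ x, ‖gradient φ x‖ ≤ C := by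
  obtain ⟨C, hC⟩ := (gradient_continuous φ).bounded_above_of_compact_support
    (gradient_hasCompactSupport φ)
  exact ⟨C, (norm_nonneg _).trans (hC 0), hC⟩

theorem test_eq_zero_of_notMem (φ : 𝓓(Ω, ℝ)) {x : EuclideanSpace ℝ (Fin d)} (hx : x ∉ Ω) :
    φ x = 0 := image_eq_zero_of_notMem_tsupport fun h => hx (φ.tsupport_subset h)

theorem gradient_eq_zero_of_notMem (φ : 𝓓(Ω, ℝ)) {x : EuclideanSpace ℝ (Fin d)} (hx : x ∉ Ω) :
    gradient φ x = 0 := by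
  have : fderiv ℝ φ x = 0 := by
    have h := support_fderiv_subset ℝ (f := φ)
    by_contra h'
    exact hx (φ.tsupport_subset (h h'))
  rw [gradient, this, map_zero]

theorem isFiniteMeasure_restrict (hΩ : Bornology.IsBounded (Ω : Set (EuclideanSpace ℝ (Fin d)))) :
    IsFiniteMeasure (volume.restrict (Ω : Set (EuclideanSpace ℝ (Fin d)))) :=
  ⟨by simpa using hΩ.measure_lt_top⟩

/-- Integration by parts for test functions. -/
theorem integral_test_mul_fderiv (φ ψ : 𝓓(Ω, ℝ)) (v : EuclideanSpace ℝ (Fin d)) :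
    ∫ x in (Ω : Set (EuclideanSpace ℝ (Fin d))), φ x * fderiv ℝ ψ x v =
      -∫ x in (Ω : Set (EuclideanSpace ℝ (Fin d))), inner ℝ (gradient φ x) v * ψ x := by
  rw [setIntegral_eq_integral_of_forall_compl_eq_zero
      (fun x hx => by rw [test_eq_zero_of_notMem φ hx, zero_mul]),
    setIntegral_eq_integral_of_forall_compl_eq_zero
      (fun x hx => by rw [test_eq_zero_of_notMem ψ hx, mul_zero])]
  simp_rw [inner_gradient_left]
  have cφ : Continuous fun x => fderiv ℝ φ x v :=
    (φ.contDiff.continuous_fderiv (by simp)).clm_apply continuous_const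
  have cψ : Continuous fun x => fderiv ℝ ψ x v :=
    (ψ.contDiff.continuous_fderiv (by simp)).clm_apply continuous_const
  apply integral_mul_fderiv_eq_neg_fderiv_mul_of_integrable
  · exact (cφ.mul ψ.continuous).integrable_of_hasCompactSupport ψ.hasCompactSupport.mul_left
  · exact (φ.continuous.mul cψ).integrable_of_hasCompactSupport φ.hasCompactSupport.mul_right
  · exact (φ.continuous.mul ψ.continuous).integrable_of_hasCompactSupport
      φ.hasCompactSupport.mul_right
  · exact fun x _ => test_differentiable φ x
  · exact fun x _ => test_differentiable ψ x

end TestFunctions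

/-! ### Limits of test functions and weak gradients -/

/-- The test functions `φ n` converge to `u`, and their gradients to `G`, in `L^p(Ω)`. -/
structure IsSobolevLimit (p : ℝ) (Ω : Opens (EuclideanSpace ℝ (Fin d))) (φ : ℕ → 𝓓(Ω, ℝ))
    (u : EuclideanSpace ℝ (Fin d) → ℝ)
    (G : EuclideanSpace ℝ (Fin d) → EuclideanSpace ℝ (Fin d)) : Prop where
  memLp : MemLp u (ENNReal.ofReal p) (volume.restrict Ω)
  memLp_grad : MemLp G (ENNReal.ofReal p) (volume.restrict Ω)
  tendsto : Tendsto (fun n => eLpNorm (fun x => u x - φ n x) (ENNReal.ofReal p)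
    (volume.restrict Ω)) atTop (𝓝 0)
  tendsto_grad : Tendsto (fun n => eLpNorm (fun x => G x - gradient (φ n) x) (ENNReal.ofReal p)
    (volume.restrict Ω)) atTop (𝓝 0)

theorem one_le_ofReal (hp : 1 < p) : 1 ≤ ENNReal.ofReal p := by
  rw [ENNReal.one_le_ofReal]; exact hp.le

/-- Integrals against bounded functions are continuous under `L^p` convergence on a finite measure
space. -/
theorem tendsto_integral_of_eLpNorm {α : Type*} [MeasurableSpace α] {μ : Measure α}
    [IsFiniteMeasure μ] {q : ℝ≥0∞} (hq : 1 ≤ q) {f : α → ℝ} {g : ℕ → α → ℝ}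
    (hf : MemLp f q μ) (hg : ∀ n, MemLp (g n) q μ)
    (h : Tendsto (fun n => eLpNorm (fun x => f x - g n x) q μ) atTop (𝓝 0))
    {b : α → ℝ} (hb : AEStronglyMeasurable b μ) {C : ℝ} (hC : ∀ x, |b x| ≤ C) :
    Tendsto (fun n => ∫ x, g n x * b x ∂μ) atTop (𝓝 (∫ x, f x * b x ∂μ)) := by
  have hfi : Integrable f μ := hf.integrable hq
  have hgi : ∀ n, Integrable (g n) μ := fun n => (hg n).integrable hq
  apply tendsto_integral_of_L1
  · exact (hfi.mul_bdd hb (c := C) (Eventually.of_forall hC)).1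
  · exact Eventually.of_forall fun n => (hgi n).mul_bdd hb (c := C) (Eventually.of_forall hC)
  · have h1 : Tendsto (fun n => ENNReal.ofReal C * (eLpNorm (fun x => f x - g n x) q μ *
        μ Set.univ ^ (1 / (1 : ℝ≥0∞).toReal - 1 / q.toReal))) atTop (𝓝 0) := by
      have hfin : μ Set.univ ^ (1 / (1 : ℝ≥0∞).toReal - 1 / q.toReal) ≠ ⊤ := by
        apply ENNReal.rpow_ne_top_of_nonneg _ (measure_ne_top _ _)
        rcases eq_or_ne q ⊤ with rfl | hq'
        · simp
        have : 1 ≤ q.toReal := by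
          rw [← ENNReal.toReal_one]; exact ENNReal.toReal_mono hq' hq
        have := (div_le_one (by linarith)).2 this
        simpa using this
      have := ENNReal.Tendsto.mul_const h (Or.inr hfin)
      rw [zero_mul] at this
      have := ENNReal.Tendsto.const_mul this (Or.inr (ENNReal.ofReal_ne_top (r := C)))
      rwa [mul_zero] at this
    refine tendsto_of_tendsto_of_tendsto_of_le_of_le tendsto_const_nhds h1
      (fun n => zero_le) (fun n => ?_)
    have h2 := eLpNorm_le_eLpNorm_mul_rpow_measure_univ hq (hf.1.sub (hg n).1)
    refine le_trans ?_ (mul_le_mul_right h2 _)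
    rw [← eLpNorm_one_eq_lintegral_enorm]
    apply eLpNorm_le_mul_eLpNorm_of_ae_le_mul
    refine Eventually.of_forall fun x => ?_
    rw [← sub_mul, norm_mul, mul_comm, norm_sub_rev]
    exact mul_le_mul_of_nonneg_right (hC x) (norm_nonneg _)

/-- Each `φ n` satisfies the integration by parts identity. Both sides pass to the limit, because a
test function and its derivatives are bounded and `L^p` convergence on a set of finite measure
controls integrals against bounded functions. -/
theorem IsSobolevLimit.hasWeakGradient (hp : 1 < p)
    (hΩ : Bornology.IsBounded (Ω : Set (EuclideanSpace ℝ (Fin d))))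
    {φ : ℕ → 𝓓(Ω, ℝ)} {u : EuclideanSpace ℝ (Fin d) → ℝ}
    {G : EuclideanSpace ℝ (Fin d) → EuclideanSpace ℝ (Fin d)}
    (h : IsSobolevLimit p Ω φ u G) : HasWeakGradient Ω u G := by
  have := isFiniteMeasure_restrict hΩ
  have hp1 := one_le_ofReal hp
  refine ⟨IntegrableOn.locallyIntegrableOn (h.memLp.integrable hp1),
    IntegrableOn.locallyIntegrableOn (h.memLp_grad.integrable hp1), fun ψ v => ?_⟩
  obtain ⟨C, -, hC⟩ := test_bounded ψ
  obtain ⟨C', -, hC'⟩ := gradient_bounded ψ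
  have cψ : Continuous fun x => fderiv ℝ ψ x v :=
    (ψ.contDiff.continuous_fderiv (by simp)).clm_apply continuous_const
  have h1 := tendsto_integral_of_eLpNorm hp1 h.memLp (fun n => test_memLp (φ n) _) h.tendsto
    (b := fun x => fderiv ℝ ψ x v) cψ.aestronglyMeasurable (C := C' * ‖v‖) (fun x => by
      rw [← Real.norm_eq_abs]
      refine (ContinuousLinearMap.le_opNorm _ _).trans ?_
      rw [← gradient_norm]
      exact mul_le_mul_of_nonneg_right (hC' x) (norm_nonneg _))
  have hin : ∀ {H : EuclideanSpace ℝ (Fin d) → EuclideanSpace ℝ (Fin d)},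
      MemLp H (ENNReal.ofReal p) (volume.restrict (Ω : Set (EuclideanSpace ℝ (Fin d)))) →
      MemLp (fun x => inner ℝ (H x) v) (ENNReal.ofReal p)
        (volume.restrict (Ω : Set (EuclideanSpace ℝ (Fin d)))) := fun {H} hH => by
    refine MemLp.of_le_mul (c := ‖v‖) hH (hH.1.inner aestronglyMeasurable_const)
      (Eventually.of_forall fun x => ?_)
    rw [mul_comm]; exact norm_inner_le_norm _ _
  have h2 := tendsto_integral_of_eLpNorm hp1 (hin h.memLp_grad)
    (fun n => hin (gradient_memLp (φ n) _)) (b := ψ) (C := C) (by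
      have := ENNReal.Tendsto.const_mul h.tendsto_grad
        (Or.inr (ENNReal.ofReal_ne_top (r := ‖v‖)))
      rw [mul_zero] at this
      refine tendsto_of_tendsto_of_tendsto_of_le_of_le tendsto_const_nhds this
        (fun n => zero_le) (fun n => ?_)
      apply eLpNorm_le_mul_eLpNorm_of_ae_le_mul
      refine Eventually.of_forall fun x => ?_
      rw [← inner_sub_left, mul_comm]; exact norm_inner_le_norm _ _)
    ψ.continuous.aestronglyMeasurable hC
  refine tendsto_nhds_unique h1 ?_
  simp_rw [integral_test_mul_fderiv]
  exact h2.neg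

theorem HasWeakGradient.congr {u w : EuclideanSpace ℝ (Fin d) → ℝ}
    {G : EuclideanSpace ℝ (Fin d) → EuclideanSpace ℝ (Fin d)}
    (h : HasWeakGradient Ω u G)
    (huw : u =ᵐ[volume.restrict (Ω : Set (EuclideanSpace ℝ (Fin d)))] w) :
    HasWeakGradient Ω w G := by
  refine ⟨?_, h.2.1, fun φ v => ?_⟩
  · rw [locallyIntegrableOn_iff (Ω.isOpen.isLocallyClosed)] at *
    intro k hk hkc
    exact (h.1.integrableOn_compact_subset hk hkc).congr
      (ae_restrict_of_ae_restrict_of_subset hk huw)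
  · rw [← h.2.2 φ v]
    refine integral_congr_ae ?_
    filter_upwards [huw] with x hx
    rw [hx]

theorem integrable_smul_test {F : Type*} [NormedAddCommGroup F] [NormedSpace ℝ F]
    {G : EuclideanSpace ℝ (Fin d) → F}
    (hG : LocallyIntegrableOn G (Ω : Set (EuclideanSpace ℝ (Fin d)))) (g : 𝓓(Ω, ℝ)) :
    Integrable (fun x => g x • G x) := by
  have hs : Function.support (fun x => g x • G x) ⊆ tsupport g := fun x hx => by
    apply subset_tsupport
    intro h0
    apply hx
    simp [h0]
  rw [← integrableOn_iff_integrable_of_support_subset hs]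
  obtain ⟨C, -, hC⟩ := test_bounded g
  exact (hG.integrableOn_compact_subset g.tsupport_subset g.hasCompactSupport).bdd_smul
    C g.continuous.aestronglyMeasurable (Eventually.of_forall hC)

/-- This is the fundamental lemma of the calculus of variations for `G - H`. The vector-valued
integrals are compared by pairing them with an arbitrary direction `v`, which is how the weak
gradient is tested. -/
theorem HasWeakGradient.ae_unique {u : EuclideanSpace ℝ (Fin d) → ℝ}
    {G H : EuclideanSpace ℝ (Fin d) → EuclideanSpace ℝ (Fin d)}
    (hG : HasWeakGradient Ω u G) (hH : HasWeakGradient Ω u H) :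
    G =ᵐ[volume.restrict (Ω : Set (EuclideanSpace ℝ (Fin d)))] H := by
  have key := IsOpen.ae_eq_zero_of_integral_contDiff_smul_eq_zero (f := G - H) Ω.isOpen
    (hG.2.1.sub hH.2.1) (μ := volume) (fun g hg hgc hgs => by
      let φ : 𝓓(Ω, ℝ) := ⟨g, hg, hgc, hgs⟩
      have iG : Integrable (fun x => g x • G x) := integrable_smul_test hG.2.1 φ
      have iH : Integrable (fun x => g x • H x) := integrable_smul_test hH.2.1 φ
      simp only [Pi.sub_apply, smul_sub]
      rw [integral_sub iG iH, sub_eq_zero]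
      refine ext_inner_left ℝ fun v => ?_
      rw [← integral_inner iG, ← integral_inner iH]
      have e : ∀ K : EuclideanSpace ℝ (Fin d) → EuclideanSpace ℝ (Fin d),
          ∫ x, inner ℝ v (g x • K x) =
          ∫ x in (Ω : Set (EuclideanSpace ℝ (Fin d))), inner ℝ (K x) v * φ x := fun K => by
        rw [setIntegral_eq_integral_of_forall_compl_eq_zero
          (fun x hx => by rw [test_eq_zero_of_notMem φ hx, mul_zero])]
        congr 1 with x
        rw [inner_smul_right, real_inner_comm, mul_comm]; rfl
      rw [e G, e H]
      have h1 := hG.2.2 φ v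
      rw [hH.2.2 φ v] at h1
      exact (neg_injective h1).symm)
  rw [EventuallyEq, ae_restrict_iff' Ω.isOpen.measurableSet]
  filter_upwards [key] with x hx hxΩ
  exact sub_eq_zero.1 (hx hxΩ)

/-- `weakGradient` is an arbitrary choice, so the estimates below carry an explicit gradient `G`.
This lemma is the bridge back to the definitions of the norm and of the capacity. -/
theorem HasWeakGradient.weakGradient_ae_eq {u : EuclideanSpace ℝ (Fin d) → ℝ}
    {G : EuclideanSpace ℝ (Fin d) → EuclideanSpace ℝ (Fin d)} (hG : HasWeakGradient Ω u G) :
    weakGradient Ω u =ᵐ[volume.restrict (Ω : Set (EuclideanSpace ℝ (Fin d)))] G := by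
  have h : ∃ G, HasWeakGradient Ω u G := ⟨G, hG⟩
  rw [weakGradient, dif_pos h]
  exact h.choose_spec.ae_unique hG

theorem MemW1pZero.exists_isSobolevLimit {u : EuclideanSpace ℝ (Fin d) → ℝ}
    (hu : MemW1pZero p Ω u) : ∃ φ, IsSobolevLimit p Ω φ u (weakGradient Ω u) := by
  obtain ⟨⟨hm, G, hG, hGm⟩, φ, h1, h2⟩ := hu
  exact ⟨φ, hm, hGm.ae_eq hG.weakGradient_ae_eq.symm, h1, h2⟩

theorem IsSobolevLimit.memW1pZero (hp : 1 < p)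
    (hΩ : Bornology.IsBounded (Ω : Set (EuclideanSpace ℝ (Fin d))))
    {φ : ℕ → 𝓓(Ω, ℝ)} {u : EuclideanSpace ℝ (Fin d) → ℝ}
    {G : EuclideanSpace ℝ (Fin d) → EuclideanSpace ℝ (Fin d)}
    (h : IsSobolevLimit p Ω φ u G) : MemW1pZero p Ω u := by
  have hw := h.hasWeakGradient hp hΩ
  refine ⟨⟨h.memLp, G, hw, h.memLp_grad⟩, φ, h.tendsto, ?_⟩
  refine h.tendsto_grad.congr fun n => eLpNorm_congr_ae ?_
  filter_upwards [hw.weakGradient_ae_eq] with x hx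
  rw [hx]

theorem isSobolevLimit_const (φ : 𝓓(Ω, ℝ)) :
    IsSobolevLimit p Ω (fun _ => φ) φ (gradient φ) :=
  ⟨test_memLp φ _, gradient_memLp φ _, by simp, by simp⟩

theorem sobolevNorm_eq_of_hasWeakGradient (hp : 1 < p) {u : EuclideanSpace ℝ (Fin d) → ℝ}
    {G : EuclideanSpace ℝ (Fin d) → EuclideanSpace ℝ (Fin d)} (hG : HasWeakGradient Ω u G)
    (hm : MemLp G (ENNReal.ofReal p) (volume.restrict (Ω : Set (EuclideanSpace ℝ (Fin d))))) :
    sobolevNorm p Ω u = (eLpNorm G (ENNReal.ofReal p)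
      (volume.restrict (Ω : Set (EuclideanSpace ℝ (Fin d))))).toReal := by
  have h0 : ENNReal.ofReal p ≠ 0 := (zero_lt_one.trans_le (one_le_ofReal hp)).ne'
  have hp0 : (0 : ℝ) ≤ p := by linarith
  rw [hm.eLpNorm_eq_integral_rpow_norm h0 ENNReal.ofReal_ne_top, ENNReal.toReal_ofReal
    (by positivity), sobolevNorm, ENNReal.toReal_ofReal hp0, one_div]
  congr 1
  refine integral_congr_ae ?_
  filter_upwards [hG.weakGradient_ae_eq] with x hx
  rw [hx]

theorem sobolevNorm_test (hp : 1 < p)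
    (hΩ : Bornology.IsBounded (Ω : Set (EuclideanSpace ℝ (Fin d)))) (φ : 𝓓(Ω, ℝ)) :
    sobolevNorm p Ω φ = (eLpNorm (gradient φ) (ENNReal.ofReal p)
      (volume.restrict (Ω : Set (EuclideanSpace ℝ (Fin d))))).toReal :=
  sobolevNorm_eq_of_hasWeakGradient hp ((isSobolevLimit_const φ).hasWeakGradient hp hΩ)
    (gradient_memLp φ _)

/-! ### Competitors for the capacity -/

theorem lintegral_weakGradient_eq (hp : 1 < p) {u : EuclideanSpace ℝ (Fin d) → ℝ}
    {G : EuclideanSpace ℝ (Fin d) → EuclideanSpace ℝ (Fin d)} (hG : HasWeakGradient Ω u G) :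
    ∫⁻ x in (Ω : Set (EuclideanSpace ℝ (Fin d))), ‖weakGradient Ω u x‖ₑ ^ p =
      eLpNorm G (ENNReal.ofReal p)
        (volume.restrict (Ω : Set (EuclideanSpace ℝ (Fin d)))) ^ p := by
  have h0 : ENNReal.ofReal p ≠ 0 := (zero_lt_one.trans_le (one_le_ofReal hp)).ne'
  have hp0 : (0 : ℝ) ≤ p := by linarith
  rw [eLpNorm_eq_lintegral_rpow_enorm_toReal h0 ENNReal.ofReal_ne_top,
    ENNReal.toReal_ofReal hp0, ← ENNReal.rpow_mul, one_div, inv_mul_cancel₀ (by linarith),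
    ENNReal.rpow_one]
  refine lintegral_congr_ae ?_
  filter_upwards [hG.weakGradient_ae_eq] with x hx
  rw [hx]

/-- Every competitor bounds the capacity from above. -/
theorem capacity_le (hp : 1 < p)
    (hΩ : Bornology.IsBounded (Ω : Set (EuclideanSpace ℝ (Fin d))))
    {φ : ℕ → 𝓓(Ω, ℝ)} {u : EuclideanSpace ℝ (Fin d) → ℝ}
    {G : EuclideanSpace ℝ (Fin d) → EuclideanSpace ℝ (Fin d)}
    (h : IsSobolevLimit p Ω φ u G) {U : Set (EuclideanSpace ℝ (Fin d))} (hU : IsOpen U)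
    (hUΩ : U ⊆ Ω) (h1 : ∀ᵐ x ∂volume.restrict U, 1 ≤ u x) :
    capacity p Ω U ≤ eLpNorm G (ENNReal.ofReal p)
        (volume.restrict (Ω : Set (EuclideanSpace ℝ (Fin d)))) ^ p := by
  rw [← lintegral_weakGradient_eq hp (h.hasWeakGradient hp hΩ)]
  exact iInf₂_le u ⟨h.memW1pZero hp hΩ, U, hU, subset_rfl, hUΩ, h1⟩

/-- A set of small capacity has a competitor of small norm. -/
theorem exists_of_capacity_lt (hp : 1 < p) {A : Set (EuclideanSpace ℝ (Fin d))} {ε : ℝ≥0∞}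
    (hA : capacity p Ω A < ε ^ p) :
    ∃ (φ : ℕ → 𝓓(Ω, ℝ)) (u : EuclideanSpace ℝ (Fin d) → ℝ)
      (G : EuclideanSpace ℝ (Fin d) → EuclideanSpace ℝ (Fin d))
      (U : Set (EuclideanSpace ℝ (Fin d))), IsSobolevLimit p Ω φ u G ∧ IsOpen U ∧ A ⊆ U ∧
      U ⊆ Ω ∧ (∀ᵐ x ∂volume.restrict U, 1 ≤ u x) ∧
      eLpNorm G (ENNReal.ofReal p)
        (volume.restrict (Ω : Set (EuclideanSpace ℝ (Fin d)))) < ε := by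
  simp only [capacity, iInf_lt_iff] at hA
  obtain ⟨u, ⟨hu, U, hU, hAU, hUΩ, h1⟩, hlt⟩ := hA
  obtain ⟨φ, hφ⟩ := hu.exists_isSobolevLimit
  obtain ⟨⟨-, G, hG, -⟩, -⟩ := hu
  refine ⟨φ, u, _, U, hφ, hU, hAU, hUΩ, h1, ?_⟩
  rw [lintegral_weakGradient_eq hp hG, ← eLpNorm_congr_ae hG.weakGradient_ae_eq] at hlt
  exact (ENNReal.rpow_lt_rpow_iff (by linarith)).1 hlt

theorem capacity_mono {A B : Set (EuclideanSpace ℝ (Fin d))} (h : A ⊆ B) :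
    capacity p Ω A ≤ capacity p Ω B := by
  refine le_iInf₂ fun u hu => ?_
  obtain ⟨hu, U, hU, hBU, hUΩ, h1⟩ := hu
  exact iInf₂_le u ⟨hu, U, hU, h.trans hBU, hUΩ, h1⟩

/-! ### Poincaré's inequality -/

/-- Fundamental theorem of calculus along the segment from `x` to `x + M • e`: `φ` vanishes at the
far end, since that point lies outside `Ω`. -/
theorem enorm_test_le_lintegral (φ : 𝓓(Ω, ℝ)) {x e : EuclideanSpace ℝ (Fin d)} {M : ℝ}
    (he : ‖e‖ = 1) (hM : 0 ≤ M) (hx : x + M • e ∉ Ω) :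
    ‖φ x‖ₑ ≤ eLpNorm (fun t : ℝ => gradient φ (x + t • e)) 1 (volume.restrict (Set.Ioc 0 M)) := by
  have hline : ∀ t : ℝ, HasDerivAt (fun t : ℝ => x + t • e) e t := fun t => by
    simpa using ((hasDerivAt_id t).smul_const e).const_add x
  have hderiv : ∀ t : ℝ, HasDerivAt (fun t : ℝ => φ (x + t • e)) (fderiv ℝ φ (x + t • e) e) t :=
    fun t => (test_differentiable φ _).hasFDerivAt.comp_hasDerivAt t (hline t)
  have hlc : Continuous fun t : ℝ => x + t • e := by fun_prop
  have cg : Continuous fun t : ℝ => fderiv ℝ φ (x + t • e) e :=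
    ((φ.contDiff.continuous_fderiv (by simp)).comp hlc).clm_apply continuous_const
  have hint := intervalIntegral.integral_eq_sub_of_hasDerivAt (a := 0) (b := M)
    (fun t _ => hderiv t) (cg.intervalIntegrable _ _)
  rw [test_eq_zero_of_notMem φ hx, zero_smul, add_zero, zero_sub,
    intervalIntegral.integral_of_le hM] at hint
  rw [← enorm_neg, ← hint, eLpNorm_one_eq_lintegral_enorm]
  refine (enorm_integral_le_lintegral_enorm _).trans (lintegral_mono fun t => ?_)
  rw [← ofReal_norm, ← ofReal_norm, gradient_norm]
  apply ENNReal.ofReal_le_ofReal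
  simpa [he] using (fderiv ℝ φ (x + t • e)).le_opNorm e

/-- **Poincaré's inequality** for test functions on a bounded open set. -/
theorem exists_poincare (hd : 1 ≤ d) (hp : 1 < p)
    (hΩ : Bornology.IsBounded (Ω : Set (EuclideanSpace ℝ (Fin d)))) :
    ∃ C : ℝ≥0∞, C ≠ ⊤ ∧ ∀ φ : 𝓓(Ω, ℝ),
      eLpNorm φ (ENNReal.ofReal p) (volume.restrict (Ω : Set (EuclideanSpace ℝ (Fin d)))) ≤
      C * eLpNorm (gradient φ) (ENNReal.ofReal p)
        (volume.restrict (Ω : Set (EuclideanSpace ℝ (Fin d)))) := by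
  obtain ⟨R, hR0, hR⟩ := hΩ.exists_pos_norm_le
  have h0 : ENNReal.ofReal p ≠ 0 := (zero_lt_one.trans_le (one_le_ofReal hp)).ne'
  have hp0 : (0 : ℝ) < p := by linarith
  set e : EuclideanSpace ℝ (Fin d) := EuclideanSpace.single ⟨0, hd⟩ 1 with he_def
  have he : ‖e‖ = 1 := by simp [he_def]
  -- Two points of a ball of radius `R` are at distance at most `2 * R`, so a translation by `3 * R`
  -- moves every point of `Ω` out of it.
  set M : ℝ := 3 * R with hM_def
  have hM : 0 ≤ M := by positivity
  have hout : ∀ x ∈ (Ω : Set (EuclideanSpace ℝ (Fin d))), x + M • e ∉ Ω := fun x hx hx' => by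
    have h1 := hR x hx
    have h2 := hR _ hx'
    have h3 : ‖M • e‖ ≤ ‖x + M • e‖ + ‖x‖ := by
      simpa using norm_sub_le (x + M • e) x
    rw [norm_smul, he, Real.norm_eq_abs, abs_of_nonneg hM] at h3
    linarith
  -- The Hölder constant `M ^ (1 - 1 / p)` for passing from `L^1` to `L^p` on the segment.
  set K : ℝ≥0∞ := volume.restrict (Set.Ioc 0 M) Set.univ ^
    (1 / (1 : ℝ≥0∞).toReal - 1 / (ENNReal.ofReal p).toReal) with hK
  have hKtop : K ≠ ⊤ := by
    apply ENNReal.rpow_ne_top_of_nonneg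
    · have := (div_le_one hp0).2 hp.le
      rw [ENNReal.toReal_ofReal hp0.le]
      simpa using this
    · simp
  refine ⟨(ENNReal.ofReal M * K ^ p) ^ (1 / p), ENNReal.rpow_ne_top_of_nonneg (by positivity)
    (ENNReal.mul_ne_top ENNReal.ofReal_ne_top (ENNReal.rpow_ne_top_of_nonneg hp0.le hKtop)),
    fun φ => ?_⟩
  set F : EuclideanSpace ℝ (Fin d) → ℝ≥0∞ := fun x => ‖gradient φ x‖ₑ ^ p with hF
  have hFm : Measurable F :=
    ((gradient_continuous φ).measurable.enorm).pow_const p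
  have hpt : ∀ x ∈ (Ω : Set (EuclideanSpace ℝ (Fin d))),
      ‖φ x‖ₑ ^ p ≤ (∫⁻ t in Set.Ioc 0 M, F (x + t • e)) * K ^ p := fun x hx => by
    have hcont : Continuous fun t : ℝ => gradient φ (x + t • e) :=
      (gradient_continuous φ).comp (by fun_prop)
    have h1 := (enorm_test_le_lintegral φ he hM (hout x hx)).trans
      (eLpNorm_le_eLpNorm_mul_rpow_measure_univ (one_le_ofReal hp) hcont.aestronglyMeasurable)
    refine (ENNReal.rpow_le_rpow h1 hp0.le).trans (le_of_eq ?_)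
    rw [ENNReal.mul_rpow_of_nonneg _ _ hp0.le,
      eLpNorm_eq_lintegral_rpow_enorm_toReal h0 ENNReal.ofReal_ne_top,
      ENNReal.toReal_ofReal hp0.le, ← ENNReal.rpow_mul, one_div, inv_mul_cancel₀ hp0.ne',
      ENNReal.rpow_one]
    rw [hK, ENNReal.toReal_ofReal hp0.le, one_div p]
  -- The gradient vanishes off `Ω`, so one may integrate over the whole space, where Lebesgue
  -- measure is invariant under the translations by `t • e`.
  have hfull : ∫⁻ x, F x = ∫⁻ x in (Ω : Set (EuclideanSpace ℝ (Fin d))), F x := by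
    rw [setLIntegral_eq_of_support_subset]
    intro x hx
    by_contra h
    apply hx
    simp only [hF]
    rw [gradient_eq_zero_of_notMem φ h]
    simp [hp0]
  have hswap : ∫⁻ x, ∫⁻ t in Set.Ioc 0 M, F (x + t • e) =
      ENNReal.ofReal M * ∫⁻ x, F x := by
    rw [lintegral_lintegral_swap]
    · have : ∀ t : ℝ, ∫⁻ x, F (x + t • e) = ∫⁻ x, F x := fun t =>
        lintegral_add_right_eq_self F (t • e)
      simp_rw [this]
      simp [mul_comm]
    · refine Measurable.aemeasurable ?_
      apply hFm.comp
      fun_prop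
  have hmain : ∫⁻ x in (Ω : Set (EuclideanSpace ℝ (Fin d))), ‖φ x‖ₑ ^ p ≤
      (ENNReal.ofReal M * K ^ p) * ∫⁻ x in (Ω : Set (EuclideanSpace ℝ (Fin d))), F x := by
    calc ∫⁻ x in (Ω : Set (EuclideanSpace ℝ (Fin d))), ‖φ x‖ₑ ^ p
        ≤ ∫⁻ x in (Ω : Set (EuclideanSpace ℝ (Fin d))),
          (∫⁻ t in Set.Ioc 0 M, F (x + t • e)) * K ^ p :=
          setLIntegral_mono' Ω.isOpen.measurableSet hpt
      _ ≤ ∫⁻ x, (∫⁻ t in Set.Ioc 0 M, F (x + t • e)) * K ^ p := setLIntegral_le_lintegral _ _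
      _ = (∫⁻ x, ∫⁻ t in Set.Ioc 0 M, F (x + t • e)) * K ^ p :=
          lintegral_mul_const' _ _ (ENNReal.rpow_ne_top_of_nonneg hp0.le hKtop)
      _ = _ := by rw [hswap, hfull]; ring
  rw [eLpNorm_eq_lintegral_rpow_enorm_toReal h0 ENNReal.ofReal_ne_top,
    eLpNorm_eq_lintegral_rpow_enorm_toReal h0 ENNReal.ofReal_ne_top,
    ENNReal.toReal_ofReal hp0.le, ← ENNReal.mul_rpow_of_nonneg _ _ (by positivity)]
  exact ENNReal.rpow_le_rpow hmain (by positivity)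

/-- Poincaré's inequality on `W^{1,p}_0`. -/
theorem IsSobolevLimit.poincare (hp : 1 < p) {C : ℝ≥0∞} (hC : C ≠ ⊤)
    (h : ∀ φ : 𝓓(Ω, ℝ),
      eLpNorm φ (ENNReal.ofReal p) (volume.restrict (Ω : Set (EuclideanSpace ℝ (Fin d)))) ≤
      C * eLpNorm (gradient φ) (ENNReal.ofReal p)
        (volume.restrict (Ω : Set (EuclideanSpace ℝ (Fin d)))))
    {φ : ℕ → 𝓓(Ω, ℝ)} {u : EuclideanSpace ℝ (Fin d) → ℝ}
    {G : EuclideanSpace ℝ (Fin d) → EuclideanSpace ℝ (Fin d)}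
    (hu : IsSobolevLimit p Ω φ u G) :
    eLpNorm u (ENNReal.ofReal p) (volume.restrict (Ω : Set (EuclideanSpace ℝ (Fin d)))) ≤
      C * eLpNorm G (ENNReal.ofReal p)
        (volume.restrict (Ω : Set (EuclideanSpace ℝ (Fin d)))) := by
  set lam := volume.restrict (Ω : Set (EuclideanSpace ℝ (Fin d)))
  have hp1 := one_le_ofReal hp
  have key : ∀ n, eLpNorm u (ENNReal.ofReal p) lam ≤
      eLpNorm (fun x => u x - φ n x) (ENNReal.ofReal p) lam +
      C * (eLpNorm G (ENNReal.ofReal p) lam +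
        eLpNorm (fun x => G x - gradient (φ n) x) (ENNReal.ofReal p) lam) := fun n => by
    have h1 := eLpNorm_add_le (hu.memLp.1.sub (test_memLp (φ n) (ENNReal.ofReal p)).1)
      (test_memLp (φ n) (ENNReal.ofReal p)).1 hp1
    have h2 := eLpNorm_sub_le hu.memLp_grad.1
      (hu.memLp_grad.1.sub (gradient_memLp (φ n) (ENNReal.ofReal p)).1) hp1
    rw [sub_add_cancel] at h1
    rw [sub_sub_cancel] at h2
    refine h1.trans (add_le_add le_rfl ((h _).trans (mul_le_mul_right h2 _)))
  have hlim := hu.tendsto.add (ENNReal.Tendsto.const_mul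
    (hu.tendsto_grad.const_add (eLpNorm G (ENNReal.ofReal p) lam)) (Or.inr hC))
  rw [add_zero, zero_add] at hlim
  exact ge_of_tendsto' hlim key

/-! ### Closure properties, chain rule and product rule -/

/-- Dominated convergence to zero in `L^p`. -/
theorem tendsto_eLpNorm_zero_of_dominated {α F H : Type*} [MeasurableSpace α] {μ : Measure α}
    [NormedAddCommGroup F] [NormedAddCommGroup H] (hp : 1 < p) {f : ℕ → α → F} {g : α → H}
    (hf : ∀ n, AEStronglyMeasurable (f n) μ) (hg : MemLp g (ENNReal.ofReal p) μ) {C : ℝ}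
    (hC : ∀ n, ∀ᵐ x ∂μ, ‖f n x‖ ≤ C * ‖g x‖)
    (hlim : ∀ᵐ x ∂μ, Tendsto (fun n => f n x) atTop (𝓝 0)) :
    Tendsto (fun n => eLpNorm (f n) (ENNReal.ofReal p) μ) atTop (𝓝 0) := by
  have h0 : ENNReal.ofReal p ≠ 0 := (zero_lt_one.trans_le (one_le_ofReal hp)).ne'
  have hp0 : (0 : ℝ) < p := by linarith
  have key := tendsto_lintegral_of_dominated_convergence' (μ := μ)
    (F := fun n x => ‖f n x‖ₑ ^ p) (f := fun _ => 0)
    (fun x => (ENNReal.ofReal C * ‖g x‖ₑ) ^ p) (fun n => (hf n).enorm.pow_const p)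
    (fun n => by
      filter_upwards [hC n] with x hx
      refine ENNReal.rpow_le_rpow ?_ hp0.le
      rw [← ofReal_norm, ← ofReal_norm, ← ENNReal.ofReal_mul' (norm_nonneg _)]
      exact ENNReal.ofReal_le_ofReal hx)
    (by
      simp_rw [ENNReal.mul_rpow_of_nonneg _ _ hp0.le]
      rw [lintegral_const_mul' _ _ (ENNReal.rpow_ne_top_of_nonneg hp0.le ENNReal.ofReal_ne_top)]
      refine ENNReal.mul_ne_top
        (ENNReal.rpow_ne_top_of_nonneg hp0.le ENNReal.ofReal_ne_top) ?_
      have := lintegral_rpow_enorm_lt_top_of_eLpNorm_lt_top h0 ENNReal.ofReal_ne_top hg.2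
      rw [ENNReal.toReal_ofReal hp0.le] at this
      exact this.ne)
    (by
      filter_upwards [hlim] with x hx
      have h1 : Tendsto (fun n => ‖f n x‖ₑ) atTop (𝓝 0) := by
        have := (continuous_enorm.tendsto (0 : F)).comp hx
        rwa [enorm_zero] at this
      have := (ENNReal.continuous_rpow_const (y := p)).tendsto (0 : ℝ≥0∞) |>.comp h1
      rwa [ENNReal.zero_rpow_of_pos hp0] at this)
  simp only [lintegral_const, zero_mul] at key
  have := (ENNReal.continuous_rpow_const (y := 1 / p)).tendsto (0 : ℝ≥0∞) |>.comp key
  rw [ENNReal.zero_rpow_of_pos (by positivity)] at this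
  refine this.congr fun n => ?_
  rw [eLpNorm_eq_lintegral_rpow_enorm_toReal h0 ENNReal.ofReal_ne_top,
    ENNReal.toReal_ofReal hp0.le]
  rfl

theorem exists_isSobolevLimit_of_approx {u : EuclideanSpace ℝ (Fin d) → ℝ}
    {G : EuclideanSpace ℝ (Fin d) → EuclideanSpace ℝ (Fin d)}
    (hu : MemLp u (ENNReal.ofReal p) (volume.restrict (Ω : Set (EuclideanSpace ℝ (Fin d)))))
    (hG : MemLp G (ENNReal.ofReal p) (volume.restrict (Ω : Set (EuclideanSpace ℝ (Fin d)))))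
    (h : ∀ ε : ℝ≥0∞, 0 < ε → ∃ φ : 𝓓(Ω, ℝ),
      eLpNorm (fun x => u x - φ x) (ENNReal.ofReal p) (volume.restrict Ω) ≤ ε ∧
      eLpNorm (fun x => G x - gradient φ x) (ENNReal.ofReal p) (volume.restrict Ω) ≤ ε) :
    ∃ φ, IsSobolevLimit p Ω φ u G := by
  have hε : ∀ n : ℕ, (0 : ℝ≥0∞) < (n : ℝ≥0∞)⁻¹ := fun n => by simp
  choose φ h1 h2 using fun n : ℕ => h _ (hε n)
  have lim := ENNReal.tendsto_inv_nat_nhds_zero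
  exact ⟨φ, hu, hG,
    tendsto_of_tendsto_of_tendsto_of_le_of_le tendsto_const_nhds lim (fun _ => zero_le) h1,
    tendsto_of_tendsto_of_tendsto_of_le_of_le tendsto_const_nhds lim (fun _ => zero_le) h2⟩

theorem IsSobolevLimit.exists_approx {φ : ℕ → 𝓓(Ω, ℝ)} {u : EuclideanSpace ℝ (Fin d) → ℝ}
    {G : EuclideanSpace ℝ (Fin d) → EuclideanSpace ℝ (Fin d)} (h : IsSobolevLimit p Ω φ u G)
    {ε : ℝ≥0∞} (hε : 0 < ε) : ∃ n,
      eLpNorm (fun x => u x - φ n x) (ENNReal.ofReal p) (volume.restrict Ω) ≤ ε ∧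
      eLpNorm (fun x => G x - gradient (φ n) x) (ENNReal.ofReal p) (volume.restrict Ω) ≤ ε :=
  ((h.tendsto.eventually_le_const hε).and (h.tendsto_grad.eventually_le_const hε)).exists

theorem IsSobolevLimit.comp {φ : ℕ → 𝓓(Ω, ℝ)} {u : EuclideanSpace ℝ (Fin d) → ℝ}
    {G : EuclideanSpace ℝ (Fin d) → EuclideanSpace ℝ (Fin d)} (h : IsSobolevLimit p Ω φ u G)
    {k : ℕ → ℕ} (hk : Tendsto k atTop atTop) : IsSobolevLimit p Ω (fun n => φ (k n)) u G :=
  ⟨h.memLp, h.memLp_grad, h.tendsto.comp hk, h.tendsto_grad.comp hk⟩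

theorem IsSobolevLimit.congr {φ : ℕ → 𝓓(Ω, ℝ)} {u w : EuclideanSpace ℝ (Fin d) → ℝ}
    {G : EuclideanSpace ℝ (Fin d) → EuclideanSpace ℝ (Fin d)} (h : IsSobolevLimit p Ω φ u G)
    (huw : u =ᵐ[volume.restrict (Ω : Set (EuclideanSpace ℝ (Fin d)))] w) :
    IsSobolevLimit p Ω φ w G := by
  refine ⟨h.memLp.ae_eq huw, h.memLp_grad, h.tendsto.congr fun n => eLpNorm_congr_ae ?_,
    h.tendsto_grad⟩
  filter_upwards [huw] with x hx
  rw [hx]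

theorem IsSobolevLimit.add (hp : 1 < p) {φ ψ : ℕ → 𝓓(Ω, ℝ)}
    {u w : EuclideanSpace ℝ (Fin d) → ℝ}
    {G H : EuclideanSpace ℝ (Fin d) → EuclideanSpace ℝ (Fin d)} (h : IsSobolevLimit p Ω φ u G)
    (h' : IsSobolevLimit p Ω ψ w H) :
    IsSobolevLimit p Ω (fun n => φ n + ψ n) (fun x => u x + w x) (fun x => G x + H x) := by
  have hp1 := one_le_ofReal hp
  refine ⟨h.memLp.add h'.memLp, h.memLp_grad.add h'.memLp_grad, ?_, ?_⟩
  · have := h.tendsto.add h'.tendsto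
    rw [add_zero] at this
    refine tendsto_of_tendsto_of_tendsto_of_le_of_le tendsto_const_nhds this (fun _ => zero_le)
      fun n => ?_
    refine le_trans (le_of_eq ?_) (eLpNorm_add_le (h.memLp.1.sub (test_memLp (φ n) 1).1)
      (h'.memLp.1.sub (test_memLp (ψ n) 1).1) hp1)
    congr 1 with x
    simp; ring
  · have := h.tendsto_grad.add h'.tendsto_grad
    rw [add_zero] at this
    refine tendsto_of_tendsto_of_tendsto_of_le_of_le tendsto_const_nhds this (fun _ => zero_le)
      fun n => ?_
    refine le_trans (le_of_eq ?_) (eLpNorm_add_le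
      (h.memLp_grad.1.sub (gradient_memLp (φ n) 1).1)
      (h'.memLp_grad.1.sub (gradient_memLp (ψ n) 1).1) hp1)
    congr 1 with x : 1
    simp only [gradient_add_test, Pi.add_apply]
    abel

theorem exists_isSobolevLimit_sum (hp : 1 < p) {φ : ℕ → ℕ → 𝓓(Ω, ℝ)}
    {w : ℕ → EuclideanSpace ℝ (Fin d) → ℝ}
    {G : ℕ → EuclideanSpace ℝ (Fin d) → EuclideanSpace ℝ (Fin d)}
    (h : ∀ n, IsSobolevLimit p Ω (φ n) (w n) (G n)) (N : ℕ) :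
    ∃ ψ, IsSobolevLimit p Ω ψ (fun x => ∑ n ∈ Finset.range N, w n x)
      (fun x => ∑ n ∈ Finset.range N, G n x) := by
  induction N with
  | zero =>
    refine ⟨fun _ => 0, ?_⟩
    have := isSobolevLimit_const (p := p) (0 : 𝓓(Ω, ℝ))
    convert this using 1
    · ext; simp
    · ext1 x; rw [gradient_zero_test]; simp
  | succ N ih =>
    obtain ⟨ψ, hψ⟩ := ih
    refine ⟨fun n => ψ n + φ N n, ?_⟩
    simp_rw [Finset.sum_range_succ]
    exact hψ.add hp (h N)

/-- A limit of limits of test functions is again one: approximate `u` by some `w n` within `ε / 2`,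
and that `w n` by one of its own test functions within `ε / 2`. -/
theorem exists_isSobolevLimit_of_tendsto (hp : 1 < p) {φ : ℕ → ℕ → 𝓓(Ω, ℝ)}
    {w : ℕ → EuclideanSpace ℝ (Fin d) → ℝ}
    {G : ℕ → EuclideanSpace ℝ (Fin d) → EuclideanSpace ℝ (Fin d)}
    (h : ∀ n, IsSobolevLimit p Ω (φ n) (w n) (G n))
    {u : EuclideanSpace ℝ (Fin d) → ℝ}
    {H : EuclideanSpace ℝ (Fin d) → EuclideanSpace ℝ (Fin d)}
    (hu : MemLp u (ENNReal.ofReal p) (volume.restrict (Ω : Set (EuclideanSpace ℝ (Fin d)))))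
    (hH : MemLp H (ENNReal.ofReal p) (volume.restrict (Ω : Set (EuclideanSpace ℝ (Fin d)))))
    (h1 : Tendsto (fun n => eLpNorm (fun x => u x - w n x) (ENNReal.ofReal p)
      (volume.restrict (Ω : Set (EuclideanSpace ℝ (Fin d))))) atTop (𝓝 0))
    (h2 : Tendsto (fun n => eLpNorm (fun x => H x - G n x) (ENNReal.ofReal p)
      (volume.restrict (Ω : Set (EuclideanSpace ℝ (Fin d))))) atTop (𝓝 0)) :
    ∃ ψ, IsSobolevLimit p Ω ψ u H := by
  have hp1 := one_le_ofReal hp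
  refine exists_isSobolevLimit_of_approx hu hH fun ε hε => ?_
  have hε2 : 0 < ε / 2 := ENNReal.half_pos hε.ne'
  obtain ⟨n, hn1, hn2⟩ :=
    ((h1.eventually_le_const hε2).and (h2.eventually_le_const hε2)).exists
  obtain ⟨k, hk1, hk2⟩ := (h n).exists_approx hε2
  refine ⟨φ n k, ?_, ?_⟩
  · have := eLpNorm_add_le (hu.1.sub (h n).memLp.1)
      ((h n).memLp.1.sub (test_memLp (φ n k) 1).1) hp1
    rw [sub_add_sub_cancel] at this
    exact (this.trans (add_le_add hn1 hk1)).trans_eq (ENNReal.add_halves ε)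
  · have := eLpNorm_add_le (hH.1.sub (h n).memLp_grad.1)
      ((h n).memLp_grad.1.sub (gradient_memLp (φ n k) 1).1) hp1
    rw [sub_add_sub_cancel] at this
    exact (this.trans (add_le_add hn2 hk2)).trans_eq (ENNReal.add_halves ε)

/-- Pointwise convergence is what the chain rule needs: `deriv T` is merely continuous and bounded,
so `deriv T (φ n)` is handled by dominated convergence. -/
theorem IsSobolevLimit.exists_ae_tendsto (hp : 1 < p) {φ : ℕ → 𝓓(Ω, ℝ)}
    {u : EuclideanSpace ℝ (Fin d) → ℝ}
    {G : EuclideanSpace ℝ (Fin d) → EuclideanSpace ℝ (Fin d)} (h : IsSobolevLimit p Ω φ u G) :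
    ∃ k : ℕ → ℕ, StrictMono k ∧
      ∀ᵐ x ∂volume.restrict (Ω : Set (EuclideanSpace ℝ (Fin d))),
        Tendsto (fun n => φ (k n) x) atTop (𝓝 (u x)) := by
  have h0 : ENNReal.ofReal p ≠ 0 := (zero_lt_one.trans_le (one_le_ofReal hp)).ne'
  refine (tendstoInMeasure_of_tendsto_eLpNorm h0 (fun n => (test_memLp (φ n) 1).1)
    h.memLp.1 (h.tendsto.congr fun n => ?_)).exists_seq_tendsto_ae
  exact eLpNorm_sub_comm u (φ n) _ _

/-- The chain rule in `W^{1,p}_0`. -/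
theorem IsSobolevLimit.smoothComp (hp : 1 < p) {φ : ℕ → 𝓓(Ω, ℝ)}
    {u : EuclideanSpace ℝ (Fin d) → ℝ}
    {G : EuclideanSpace ℝ (Fin d) → EuclideanSpace ℝ (Fin d)} (h : IsSobolevLimit p Ω φ u G)
    {T : ℝ → ℝ} (hT : ContDiff ℝ ((⊤ : ℕ∞) : WithTop ℕ∞) T) (h0 : T 0 = 0) {C : ℝ}
    (hC : ∀ t, |deriv T t| ≤ C) :
    ∃ k : ℕ → ℕ, StrictMono k ∧
      IsSobolevLimit p Ω (fun n => SobolevCut.smoothComp (φ (k n)) T hT h0) (fun x => T (u x))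
        (fun x => deriv T (u x) • G x) := by
  have hp1 := one_le_ofReal hp
  obtain ⟨k, hk, hlim⟩ := h.exists_ae_tendsto hp
  have h' := h.comp hk.tendsto_atTop
  have hT' : Continuous (deriv T) := hT.continuous_deriv (by simp)
  have hlip : ∀ s t, |T s - T t| ≤ C * |s - t| := fun s t => by
    have := Convex.norm_image_sub_le_of_norm_deriv_le (f := T) (C := C) (s := Set.univ)
      (fun x _ => hT.differentiable (by simp) x) (fun x _ => hC x) convex_univ
      (Set.mem_univ t) (Set.mem_univ s)
    simpa [Real.norm_eq_abs] using this
  have mT : AEStronglyMeasurable (fun x => T (u x))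
      (volume.restrict (Ω : Set (EuclideanSpace ℝ (Fin d)))) :=
    hT.continuous.comp_aestronglyMeasurable h.memLp.1
  have mG : AEStronglyMeasurable (fun x => deriv T (u x) • G x)
      (volume.restrict (Ω : Set (EuclideanSpace ℝ (Fin d)))) :=
    (hT'.comp_aestronglyMeasurable h.memLp.1).smul h.memLp_grad.1
  refine ⟨k, hk, ?_, ?_, ?_, ?_⟩
  · refine MemLp.of_le_mul (c := C) h.memLp mT (Eventually.of_forall fun x => ?_)
    simpa [h0] using hlip (u x) 0
  · refine MemLp.of_le_mul (c := C) h.memLp_grad mG (Eventually.of_forall fun x => ?_)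
    rw [norm_smul]
    exact mul_le_mul_of_nonneg_right (hC _) (norm_nonneg _)
  · have := ENNReal.Tendsto.const_mul h'.tendsto (Or.inr (ENNReal.ofReal_ne_top (r := C)))
    rw [mul_zero] at this
    refine tendsto_of_tendsto_of_tendsto_of_le_of_le tendsto_const_nhds this
      (fun n => zero_le) (fun n => ?_)
    apply eLpNorm_le_mul_eLpNorm_of_ae_le_mul
    exact Eventually.of_forall fun x => hlip _ _
  -- The gradient error splits as `(T'(u) - T'(φ_n)) G + T'(φ_n) (G - ∇φ_n)`. The first term is
  -- dominated by `2 * C * ‖G‖` and tends to zero almost everywhere; the second is at most `C` times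
  -- the gradient error of `φ_n`.
  · have c1 : Tendsto (fun n => eLpNorm
        (fun x => (deriv T (u x) - deriv T (φ (k n) x)) • G x) (ENNReal.ofReal p)
        (volume.restrict (Ω : Set (EuclideanSpace ℝ (Fin d))))) atTop (𝓝 0) := by
      refine tendsto_eLpNorm_zero_of_dominated hp (C := 2 * C) (fun n => ?_) h.memLp_grad
        (fun n => Eventually.of_forall fun x => ?_) ?_
      · exact ((hT'.comp_aestronglyMeasurable h.memLp.1).sub
          (hT'.comp (φ (k n)).continuous).aestronglyMeasurable).smul h.memLp_grad.1
      · rw [norm_smul]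
        refine mul_le_mul_of_nonneg_right ?_ (norm_nonneg _)
        refine (norm_sub_le _ _).trans ?_
        rw [two_mul]
        exact add_le_add (hC _) (hC _)
      · filter_upwards [hlim] with x hx
        have := ((hT'.tendsto (u x)).comp hx).const_sub (deriv T (u x))
        rw [sub_self] at this
        simpa using this.smul_const (G x)
    have c2 := ENNReal.Tendsto.const_mul h'.tendsto_grad
      (Or.inr (ENNReal.ofReal_ne_top (r := C)))
    have c3 := c1.add c2
    rw [mul_zero, add_zero] at c3
    refine tendsto_of_tendsto_of_tendsto_of_le_of_le tendsto_const_nhds c3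
      (fun n => zero_le) (fun n => ?_)
    have e : (fun x => deriv T (u x) • G x -
        gradient (SobolevCut.smoothComp (φ (k n)) T hT h0) x) =
        (fun x => (deriv T (u x) - deriv T (φ (k n) x)) • G x) +
        (fun x => deriv T (φ (k n) x) • (G x - gradient (φ (k n)) x)) := by
      ext1 x
      rw [gradient_smoothComp]
      simp only [Pi.add_apply, sub_smul, smul_sub]
      abel
    rw [e]
    refine (eLpNorm_add_le ?_ ?_ hp1).trans (add_le_add le_rfl ?_)
    · exact ((hT'.comp_aestronglyMeasurable h.memLp.1).sub
          (hT'.comp (φ (k n)).continuous).aestronglyMeasurable).smul h.memLp_grad.1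
    · exact ((hT'.comp (φ (k n)).continuous).aestronglyMeasurable).smul
        (h.memLp_grad.1.sub (gradient_memLp (φ (k n)) 1).1)
    · apply eLpNorm_le_mul_eLpNorm_of_ae_le_mul
      refine Eventually.of_forall fun x => ?_
      rw [norm_smul]
      exact mul_le_mul_of_nonneg_right (hC _) (norm_nonneg _)

/-- The product rule in `W^{1,p}_0` for multiplication by a test function. -/
theorem IsSobolevLimit.mulTest (hp : 1 < p) {φ : ℕ → 𝓓(Ω, ℝ)}
    {u : EuclideanSpace ℝ (Fin d) → ℝ}
    {G : EuclideanSpace ℝ (Fin d) → EuclideanSpace ℝ (Fin d)} (h : IsSobolevLimit p Ω φ u G)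
    (χ : 𝓓(Ω, ℝ)) :
    IsSobolevLimit p Ω (fun n => SobolevCut.mulTest χ (φ n)) (fun x => χ x * u x)
        (fun x => χ x • G x + u x • gradient χ x) := by
  have hp1 := one_le_ofReal hp
  obtain ⟨C, -, hC⟩ := test_bounded χ
  obtain ⟨C', -, hC'⟩ := gradient_bounded χ
  have cχ := χ.continuous.aestronglyMeasurable
    (μ := volume.restrict (Ω : Set (EuclideanSpace ℝ (Fin d))))
  have cχ' := (gradient_continuous χ).aestronglyMeasurable
    (μ := volume.restrict (Ω : Set (EuclideanSpace ℝ (Fin d))))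
  have b1 : ∀ x (w : ℝ), ‖χ x * w‖ ≤ C * ‖w‖ := fun x w => by
    rw [norm_mul]; exact mul_le_mul_of_nonneg_right (hC x) (norm_nonneg _)
  have b2 : ∀ x (w : EuclideanSpace ℝ (Fin d)), ‖χ x • w‖ ≤ C * ‖w‖ := fun x w => by
    rw [norm_smul]; exact mul_le_mul_of_nonneg_right (hC x) (norm_nonneg _)
  have b3 : ∀ x (w : ℝ), ‖w • gradient χ x‖ ≤ C' * ‖w‖ := fun x w => by
    rw [norm_smul, mul_comm]; exact mul_le_mul_of_nonneg_right (hC' x) (norm_nonneg _)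
  refine ⟨?_, ?_, ?_, ?_⟩
  · exact MemLp.of_le_mul h.memLp (cχ.mul h.memLp.1) (Eventually.of_forall fun x => b1 x _)
  · exact (MemLp.of_le_mul h.memLp_grad (cχ.smul h.memLp_grad.1)
      (Eventually.of_forall fun x => b2 x _)).add
      (MemLp.of_le_mul h.memLp (h.memLp.1.smul cχ') (Eventually.of_forall fun x => b3 x _))
  · have := ENNReal.Tendsto.const_mul h.tendsto (Or.inr (ENNReal.ofReal_ne_top (r := C)))
    rw [mul_zero] at this
    refine tendsto_of_tendsto_of_tendsto_of_le_of_le tendsto_const_nhds this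
      (fun n => zero_le) (fun n => ?_)
    apply eLpNorm_le_mul_eLpNorm_of_ae_le_mul
    refine Eventually.of_forall fun x => ?_
    rw [mulTest_apply, ← mul_sub]
    exact b1 x _
  · have c := (ENNReal.Tendsto.const_mul h.tendsto_grad
      (Or.inr (ENNReal.ofReal_ne_top (r := C)))).add
      (ENNReal.Tendsto.const_mul h.tendsto (Or.inr (ENNReal.ofReal_ne_top (r := C'))))
    rw [mul_zero, mul_zero, add_zero] at c
    refine tendsto_of_tendsto_of_tendsto_of_le_of_le tendsto_const_nhds c
      (fun n => zero_le) (fun n => ?_)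
    have e : (fun x => χ x • G x + u x • gradient χ x -
        gradient (SobolevCut.mulTest χ (φ n)) x) =
        (fun x => χ x • (G x - gradient (φ n) x)) +
        (fun x => (u x - φ n x) • gradient χ x) := by
      ext1 x
      rw [gradient_mulTest]
      simp only [Pi.add_apply, sub_smul, smul_sub]
      abel
    rw [e]
    refine (eLpNorm_add_le (cχ.smul (h.memLp_grad.1.sub (gradient_memLp (φ n) 1).1))
      ((h.memLp.1.sub (test_memLp (φ n) 1).1).smul cχ') hp1).trans (add_le_add ?_ ?_)
    · exact eLpNorm_le_mul_eLpNorm_of_ae_le_mul (Eventually.of_forall fun x => b2 x _) _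
    · exact eLpNorm_le_mul_eLpNorm_of_ae_le_mul (Eventually.of_forall fun x => b3 x _) _

/-! ### Series in `W^{1,p}_0` and countable subadditivity -/

theorem Lp_coeFn_sum_range {α F : Type*} [MeasurableSpace α] {μ : Measure α}
    [NormedAddCommGroup F] {q : ℝ≥0∞} {f : ℕ → α → F} (hf : ∀ n, MemLp (f n) q μ) (N : ℕ) :
    (∑ n ∈ Finset.range N, (hf n).toLp (f n) : Lp F q μ) =ᵐ[μ]
      fun x => ∑ n ∈ Finset.range N, f n x := by
  induction N with
  | zero =>
    simp only [Finset.range_zero, Finset.sum_empty]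
    exact Lp.coeFn_zero _ _ _
  | succ N ih =>
    rw [Finset.sum_range_succ]
    filter_upwards [ih, (hf N).coeFn_toLp, Lp.coeFn_add
      (∑ n ∈ Finset.range N, (hf n).toLp (f n)) ((hf N).toLp (f N))] with x h1 h2 h3
    rw [h3, Pi.add_apply, h1, h2, Finset.sum_range_succ]

/-- An absolutely convergent series converges in the Banach space `L^p`; this is restated for
functions in place of classes. -/
theorem exists_limit_of_tsum_eLpNorm {α F : Type*} [MeasurableSpace α] {μ : Measure α}
    [NormedAddCommGroup F] [CompleteSpace F] {q : ℝ≥0∞} (hq : 1 ≤ q) {f : ℕ → α → F}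
    (hf : ∀ n, MemLp (f n) q μ) (hs : ∑' n, eLpNorm (f n) q μ ≠ ⊤) :
    ∃ g : α → F, MemLp g q μ ∧ eLpNorm g q μ ≤ ∑' n, eLpNorm (f n) q μ ∧
      Tendsto (fun N => eLpNorm (fun x => g x - ∑ n ∈ Finset.range N, f n x) q μ)
        atTop (𝓝 0) := by
  have : Fact (1 ≤ q) := ⟨hq⟩
  have hn : ∀ n, ‖(hf n).toLp (f n)‖ = (eLpNorm (f n) q μ).toReal := fun n => Lp.norm_toLp _ _
  have hsum : Summable fun n => ‖(hf n).toLp (f n)‖ := by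
    simp_rw [hn]; exact ENNReal.summable_toReal hs
  have hs' : Summable fun n => (hf n).toLp (f n) := hsum.of_norm
  refine ⟨(∑' n, (hf n).toLp (f n) : Lp F q μ), Lp.memLp _, ?_, ?_⟩
  · rw [← ENNReal.toReal_le_toReal (Lp.eLpNorm_ne_top _) hs, ← Lp.norm_def,
      ENNReal.tsum_toReal_eq (fun n => (hf n).eLpNorm_ne_top)]
    simp_rw [← hn]
    exact norm_tsum_le_tsum_norm hsum
  · have := (Lp.tendsto_Lp_iff_tendsto_eLpNorm' _ _).1 hs'.hasSum.tendsto_sum_nat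
    refine this.congr fun N => ?_
    rw [eLpNorm_sub_comm]
    refine eLpNorm_congr_ae ?_
    filter_upwards [Lp_coeFn_sum_range hf N] with x hx
    rw [Pi.sub_apply, hx]

/-- Countable subadditivity of the capacity, in terms of competitors. -/
theorem capacity_iUnion_le (hd : 1 ≤ d) (hp : 1 < p)
    (hΩ : Bornology.IsBounded (Ω : Set (EuclideanSpace ℝ (Fin d))))
    {φ : ℕ → ℕ → 𝓓(Ω, ℝ)} {w : ℕ → EuclideanSpace ℝ (Fin d) → ℝ}
    {G : ℕ → EuclideanSpace ℝ (Fin d) → EuclideanSpace ℝ (Fin d)}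
    (h : ∀ n, IsSobolevLimit p Ω (φ n) (w n) (G n)) (hw : ∀ n x, 0 ≤ w n x)
    {U : ℕ → Set (EuclideanSpace ℝ (Fin d))} (hU : ∀ n, IsOpen (U n)) (hUΩ : ∀ n, U n ⊆ Ω)
    (h1 : ∀ n, ∀ᵐ x ∂volume.restrict (U n), 1 ≤ w n x) :
    capacity p Ω (⋃ n, U n) ≤ (∑' n, eLpNorm (G n) (ENNReal.ofReal p)
      (volume.restrict (Ω : Set (EuclideanSpace ℝ (Fin d))))) ^ p := by
  have hp1 := one_le_ofReal hp
  have hp0 : (0 : ℝ) < p := by linarith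
  rcases eq_or_ne (∑' n, eLpNorm (G n) (ENNReal.ofReal p)
      (volume.restrict (Ω : Set (EuclideanSpace ℝ (Fin d))))) ⊤ with htop | hfin
  · rw [htop, ENNReal.top_rpow_of_pos hp0]; exact le_top
  obtain ⟨C, hC, hPC⟩ := exists_poincare hd hp hΩ
  -- Only the gradients are assumed summable. Poincaré's inequality makes the functions summable
  -- too, so the sum of all the `w n` can serve as a single competitor.
  have hfin' : ∑' n, eLpNorm (w n) (ENNReal.ofReal p)
      (volume.restrict (Ω : Set (EuclideanSpace ℝ (Fin d)))) ≠ ⊤ := by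
    refine ne_top_of_le_ne_top (ENNReal.mul_ne_top hC hfin) ?_
    rw [← ENNReal.tsum_mul_left]
    exact ENNReal.tsum_le_tsum fun n => (h n).poincare hp hC hPC
  obtain ⟨u, hu, -, hul⟩ := exists_limit_of_tsum_eLpNorm hp1 (fun n => (h n).memLp) hfin'
  obtain ⟨H, hH, hHle, hHl⟩ := exists_limit_of_tsum_eLpNorm hp1 (fun n => (h n).memLp_grad) hfin
  choose ψ hψ using fun N => exists_isSobolevLimit_sum hp h N
  obtain ⟨θ, hθ⟩ := exists_isSobolevLimit_of_tendsto hp hψ hu hH hul hHl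
  refine (capacity_le hp hΩ hθ (isOpen_iUnion hU) (Set.iUnion_subset hUΩ) ?_).trans
    (ENNReal.rpow_le_rpow hHle hp0.le)
  rw [ae_restrict_iUnion_iff]
  intro m
  -- Along a subsequence the partial sums converge almost everywhere. Once they include index `m`
  -- they dominate `w m`, since all terms are nonnegative, and so they are at least 1 on `U m`.
  obtain ⟨k, hk, hlim⟩ := (tendstoInMeasure_of_tendsto_eLpNorm
    (zero_lt_one.trans_le hp1).ne' (fun N => (hψ N).memLp.1)
    hu.1 (hul.congr fun n => eLpNorm_sub_comm u _ _ _)).exists_seq_tendsto_ae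
  filter_upwards [h1 m, ae_restrict_of_ae_restrict_of_subset (hUΩ m) hlim] with x hx1 hx2
  refine ge_of_tendsto hx2 ?_
  filter_upwards [hk.tendsto_atTop.eventually_gt_atTop m] with n hn
  exact hx1.trans (Finset.single_le_sum (f := fun n => w n x) (fun i _ => hw i x)
    (Finset.mem_range.2 hn))

/-! ### Smooth truncations and quasi-everywhere statements -/

theorem exists_deriv_bound {T : ℝ → ℝ} (hT : ContDiff ℝ ((⊤ : ℕ∞) : WithTop ℕ∞) T)
    (hc : HasCompactSupport T) : ∃ C, 0 ≤ C ∧ ∀ t, |deriv T t| ≤ C := by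
  obtain ⟨C, hC⟩ := (hT.continuous_deriv (by simp)).bounded_above_of_compact_support hc.deriv
  exact ⟨C, (norm_nonneg _).trans (hC 0), hC⟩

/-- A smooth even step function. -/
theorem exists_smooth_step : ∃ (T : ℝ → ℝ) (C : ℝ), ContDiff ℝ ((⊤ : ℕ∞) : WithTop ℕ∞) T ∧
    T 0 = 0 ∧ (∀ t, 0 ≤ T t) ∧ (∀ t, T t ≤ 1) ∧ (∀ t, 1 ≤ |t| → T t = 1) ∧ 0 ≤ C ∧
    ∀ t, |deriv T t| ≤ C := by
  -- A smooth substitute for `min |t| 1`: the square makes it even. Its derivative is bounded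
  -- because `1 - T` has compact support.
  set T : ℝ → ℝ := fun t => Real.smoothTransition (t ^ 2) with hTdef
  have hT : ContDiff ℝ ((⊤ : ℕ∞) : WithTop ℕ∞) T :=
    Real.smoothTransition.contDiff.comp (contDiff_id.pow 2)
  have h1 : ∀ t, 1 ≤ |t| → T t = 1 := fun t ht =>
    Real.smoothTransition.one_of_one_le ((one_le_sq_iff_one_le_abs t).2 ht)
  have hc : HasCompactSupport fun t => 1 - T t :=
    HasCompactSupport.intro (isCompact_Icc (a := (-1 : ℝ)) (b := 1)) fun t ht => by
      rw [h1, sub_self]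
      by_contra hlt
      exact ht (Set.mem_Icc.2 (abs_le.1 (not_le.1 hlt).le))
  obtain ⟨C, hC0, hC⟩ := exists_deriv_bound (contDiff_const.sub hT) hc
  refine ⟨T, C, hT, ?_, fun t => Real.smoothTransition.nonneg _,
    fun t => Real.smoothTransition.le_one _, h1, hC0, fun t => ?_⟩
  · simp [hTdef]
  · have := hC t
    rwa [deriv_const_sub, abs_neg] at this

/-- A smooth truncation at height `M`. -/
theorem exists_smooth_truncation (M : ℝ) : ∃ (T : ℝ → ℝ) (C : ℝ),
    ContDiff ℝ ((⊤ : ℕ∞) : WithTop ℕ∞) T ∧ T 0 = 0 ∧ (∀ t, |t| ≤ M → T t = t) ∧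
    (∀ t, |T t| ≤ C) ∧ ∀ t, |deriv T t| ≤ C := by
  set T : ℝ → ℝ := fun t => t * Real.smoothTransition (M ^ 2 + 1 - t ^ 2) with hTdef
  have hT : ContDiff ℝ ((⊤ : ℕ∞) : WithTop ℕ∞) T :=
    contDiff_id.mul (Real.smoothTransition.contDiff.comp
      (contDiff_const.sub (contDiff_id.pow 2)))
  have hc : HasCompactSupport T :=
    HasCompactSupport.intro (isCompact_Icc (a := -(|M| + 1)) (b := |M| + 1)) fun t ht => by
      have hlt : |M| + 1 < |t| := by
        by_contra hle
        exact ht (Set.mem_Icc.2 (abs_le.1 (not_lt.1 hle)))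
      have : M ^ 2 + 1 - t ^ 2 ≤ 0 := by
        rw [← sq_abs M, ← sq_abs t]
        nlinarith [abs_nonneg M]
      simp only [hTdef, Real.smoothTransition.zero_of_nonpos this, mul_zero]
  obtain ⟨C, hC0, hC⟩ := exists_deriv_bound hT hc
  obtain ⟨C', hC'⟩ := hT.continuous.bounded_above_of_compact_support hc
  refine ⟨T, max C C', hT, by simp [hTdef], fun t ht => ?_,
    fun t => (hC' t).trans (le_max_right _ _), fun t => (hC t).trans (le_max_left _ _)⟩
  have h2 : t ^ 2 ≤ M ^ 2 := sq_le_sq' (abs_le.1 ht).1 (abs_le.1 ht).2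
  simp only [hTdef]
  rw [Real.smoothTransition.one_of_one_le (by linarith), mul_one]

theorem eq_zero_of_forall_le_rpow (hp : 1 < p) {a K : ℝ≥0∞} (hK : K ≠ ⊤)
    (h : ∀ ε : ℝ≥0∞, 0 < ε → a ≤ (K * ε) ^ p) : a = 0 := by
  have lim : Tendsto (fun n : ℕ => (K * (n : ℝ≥0∞)⁻¹) ^ p) atTop (𝓝 0) := by
    have h1 := ENNReal.Tendsto.const_mul ENNReal.tendsto_inv_nat_nhds_zero (Or.inr hK)
    have := (ENNReal.continuous_rpow_const (y := p)).tendsto _ |>.comp h1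
    rwa [mul_zero, ENNReal.zero_rpow_of_pos (by linarith)] at this
  exact le_antisymm (ge_of_tendsto' lim fun n => h _ (by simp)) zero_le

/-- Quasicontinuous functions that agree almost everywhere agree quasi-everywhere. -/
theorem Quasicontinuous.capacity_ne_eq_zero (hp : 1 < p)
    (hΩ : Bornology.IsBounded (Ω : Set (EuclideanSpace ℝ (Fin d))))
    {f g : EuclideanSpace ℝ (Fin d) → ℝ} (hf : Quasicontinuous p Ω f)
    (hg : Quasicontinuous p Ω g)
    (hfg : f =ᵐ[volume.restrict (Ω : Set (EuclideanSpace ℝ (Fin d)))] g) :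
    capacity p Ω {x | x ∈ Ω ∧ f x ≠ g x} = 0 := by
  have hp0 : (0 : ℝ) < p := by linarith
  have hp1 := one_le_ofReal hp
  obtain ⟨T, C, hT, hT0, hTnn, -, hT1, hC0, hC⟩ := exists_smooth_step
  refine eq_zero_of_forall_le_rpow hp (K := ENNReal.ofReal C * 2)
    (ENNReal.mul_ne_top ENNReal.ofReal_ne_top (by simp)) fun ε hε => ?_
  have hεp : 0 < ε ^ p := ENNReal.rpow_pos_of_nonneg hε hp0.le
  obtain ⟨U, hUo, hUΩ, hUc, hUf⟩ := hf _ hεp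
  obtain ⟨V, hVo, hVΩ, hVc, hVg⟩ := hg _ hεp
  obtain ⟨φ, u, G, U', hu, -, hUU', -, hu1, hGε⟩ := exists_of_capacity_lt hp hUc
  obtain ⟨ψ, v, H, V', hv, -, hVV', -, hv1, hHε⟩ := exists_of_capacity_lt hp hVc
  -- The competitors `u` and `v` may be negative somewhere. `T(u)` and `T(v)` are nonnegative and
  -- still equal 1 on the neighbourhoods, so `T(u) + T(v)` works for both sets at once, with
  -- gradient norm at most `2 * C * ε`.
  obtain ⟨k, -, hk⟩ := hu.smoothComp hp hT hT0 hC
  obtain ⟨l, -, hl⟩ := hv.smoothComp hp hT hT0 hC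
  have hsum := hk.add hp hl
  set D : Set (EuclideanSpace ℝ (Fin d)) := {x | x ∈ Ω ∧ f x ≠ g x} with hD
  -- `D` itself need not be open. But `f` and `g` are continuous on `Ω \ (U ∪ V)`, so at a point of
  -- `D` outside `U ∪ V` they stay different nearby on that set, and the remaining nearby points lie
  -- in `U ∪ V`.
  have hopen : IsOpen (U ∪ V ∪ D) := by
    rw [isOpen_iff_mem_nhds]
    intro x hx
    by_cases hxU : x ∈ U ∪ V
    · exact mem_of_superset ((hUo.union hVo).mem_nhds hxU) Set.subset_union_left
    have hxD : x ∈ D := hx.resolve_left hxU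
    simp only [Set.mem_union, not_or] at hxU
    have c1 : ContinuousWithinAt f ((Ω : Set (EuclideanSpace ℝ (Fin d))) \ (U ∪ V)) x :=
      (hUf x ⟨hxD.1, hxU.1⟩).mono fun y hy => ⟨hy.1, fun h => hy.2 (Or.inl h)⟩
    have c2 : ContinuousWithinAt g ((Ω : Set (EuclideanSpace ℝ (Fin d))) \ (U ∪ V)) x :=
      (hVg x ⟨hxD.1, hxU.2⟩).mono fun y hy => ⟨hy.1, fun h => hy.2 (Or.inr h)⟩
    have hne := (c1.tendsto.prodMk_nhds c2.tendsto).eventually (isOpen_ne_fun continuous_fst continuous_snd |>.mem_nhds hxD.2)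
    rw [eventually_nhdsWithin_iff] at hne
    filter_upwards [hne, Ω.isOpen.mem_nhds hxD.1] with y hy hyΩ
    by_cases hyU : y ∈ U ∪ V
    · exact Or.inl hyU
    · exact Or.inr ⟨hyΩ, hy ⟨hyΩ, hyU⟩⟩
  have hsub : U ∪ V ∪ D ⊆ Ω := Set.union_subset (Set.union_subset hUΩ hVΩ) fun x hx => hx.1
  -- Competitors are tested only almost everywhere, so adding the null set `D` to `U ∪ V` costs
  -- nothing once the union is open.
  have hDnull : volume D = 0 := by
    have := hfg
    rw [EventuallyEq, ae_restrict_iff' Ω.isOpen.measurableSet, ae_iff] at this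
    convert this using 2
    ext x
    simp [hD]
  refine (capacity_mono Set.subset_union_right).trans ((capacity_le hp hΩ hsum hopen hsub
    ?_).trans (ENNReal.rpow_le_rpow ?_ hp0.le))
  · rw [ae_restrict_union_iff, ae_restrict_union_iff]
    refine ⟨⟨?_, ?_⟩, ?_⟩
    · filter_upwards [ae_restrict_of_ae_restrict_of_subset hUU' hu1] with x hx
      rw [hT1 (u x) (hx.trans (le_abs_self _))]
      linarith [hTnn (v x)]
    · filter_upwards [ae_restrict_of_ae_restrict_of_subset hVV' hv1] with x hx
      rw [hT1 (v x) (hx.trans (le_abs_self _))]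
      linarith [hTnn (u x)]
    · rw [Measure.restrict_eq_zero.2 hDnull]
      simp
  · refine (eLpNorm_add_le hk.memLp_grad.1 hl.memLp_grad.1 hp1).trans ?_
    have b : ∀ (w : EuclideanSpace ℝ (Fin d) → ℝ)
        (K : EuclideanSpace ℝ (Fin d) → EuclideanSpace ℝ (Fin d)),
        eLpNorm K (ENNReal.ofReal p) (volume.restrict (Ω : Set (EuclideanSpace ℝ (Fin d)))) < ε →
        eLpNorm (fun x => deriv T (w x) • K x) (ENNReal.ofReal p)
          (volume.restrict (Ω : Set (EuclideanSpace ℝ (Fin d)))) ≤ ENNReal.ofReal C * ε := by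
      intro w K hK
      refine (eLpNorm_le_mul_eLpNorm_of_ae_le_mul (g := K) (c := C)
        (Eventually.of_forall fun x => ?_) _).trans (mul_le_mul_right hK.le _)
      rw [norm_smul]
      exact mul_le_mul_of_nonneg_right (hC _) (norm_nonneg _)
    refine (add_le_add (b u G hGε) (b v H hHε)).trans (le_of_eq ?_)
    ring

theorem tsum_ofReal_geometric {C : ℝ} (hC : 0 ≤ C) :
    ∑' n : ℕ, ENNReal.ofReal (C * (1 / 2) ^ n) = ENNReal.ofReal (C * 2) := by
  rw [← ENNReal.ofReal_tsum_of_nonneg (fun n => by positivity)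
    (summable_geometric_two.mul_left C), tsum_mul_left, tsum_geometric_two]

/-- A sequence of test functions converging in `W^{1,p}` has a subsequence converging
quasi-everywhere to any quasicontinuous representative of the limit. -/
theorem IsSobolevLimit.exists_subseq_quasi_tendsto (hd : 1 ≤ d) (hp : 1 < p)
    (hΩ : Bornology.IsBounded (Ω : Set (EuclideanSpace ℝ (Fin d))))
    {φ : ℕ → 𝓓(Ω, ℝ)} {u u' : EuclideanSpace ℝ (Fin d) → ℝ}
    {G : EuclideanSpace ℝ (Fin d) → EuclideanSpace ℝ (Fin d)} (h : IsSobolevLimit p Ω φ u G)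
    (hu' : Quasicontinuous p Ω u')
    (huu' : u' =ᵐ[volume.restrict (Ω : Set (EuclideanSpace ℝ (Fin d)))] u) :
    ∃ k : ℕ → ℕ, StrictMono k ∧ ∃ A B : Set (EuclideanSpace ℝ (Fin d)),
      A ⊆ Ω ∧ B ⊆ Ω ∧ capacity p Ω A = 0 ∧ capacity p Ω B = 0 ∧
      ∀ x ∈ (Ω : Set (EuclideanSpace ℝ (Fin d))), x ∉ A → x ∉ B →
        Tendsto (fun n => φ (k n) x) atTop (𝓝 (u' x)) := by
  have hp0 : (0 : ℝ) < p := by linarith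
  have hp1 := one_le_ofReal hp
  obtain ⟨T, C, hT, hT0, hTnn, -, hT1, hC0, hC⟩ := exists_smooth_step
  obtain ⟨k₁, hk₁, hae⟩ := h.exists_ae_tendsto hp
  have h' := h.comp hk₁.tendsto_atTop
  -- The rate `4⁻ⁿ` beats the weight `2ⁿ` put on the differences in `ψ n` and leaves the summable
  -- bound `2⁻ⁿ`.
  obtain ⟨k₂, hk₂, hfast⟩ := extraction_forall_of_eventually (P := fun n k =>
      eLpNorm (fun x => G x - gradient (φ (k₁ k)) x) (ENNReal.ofReal p)
        (volume.restrict (Ω : Set (EuclideanSpace ℝ (Fin d)))) ≤ ENNReal.ofReal ((1 / 4) ^ n))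
    (fun n => h'.tendsto_grad.eventually_le_const (ENNReal.ofReal_pos.2 (by positivity)))
  set k : ℕ → ℕ := fun n => k₁ (k₂ n) with hk
  have hkm : StrictMono k := hk₁.comp hk₂
  have hae' : ∀ᵐ x ∂volume.restrict (Ω : Set (EuclideanSpace ℝ (Fin d))),
      Tendsto (fun n => φ (k n) x) atTop (𝓝 (u x)) := by
    filter_upwards [hae] with x hx using hx.comp hk₂.tendsto_atTop
  set ψ : ℕ → 𝓓(Ω, ℝ) := fun n => (2 : ℝ) ^ n • (φ (k (n + 1)) - φ (k n)) with hψ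
  have hψa : ∀ n x, ψ n x = 2 ^ n * (φ (k (n + 1)) x - φ (k n) x) := fun n x => by simp [hψ]
  -- `T(ψ_n)` is nonnegative and equals 1 wherever consecutive functions differ by more than `2⁻ⁿ`.
  -- It is therefore a competitor for `E n`: a Chebyshev inequality for the capacity.
  set θ : ℕ → 𝓓(Ω, ℝ) := fun n => SobolevCut.smoothComp (ψ n) T hT hT0 with hθ
  have hdiff : ∀ n, eLpNorm (fun x => gradient (φ (k (n + 1))) x - gradient (φ (k n)) x)
      (ENNReal.ofReal p) (volume.restrict (Ω : Set (EuclideanSpace ℝ (Fin d)))) ≤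
      ENNReal.ofReal (2 * (1 / 4) ^ n) := fun n => by
    have h1 := eLpNorm_sub_le
      (h.memLp_grad.1.sub (gradient_memLp (φ (k n)) (ENNReal.ofReal p)).1)
      (h.memLp_grad.1.sub (gradient_memLp (φ (k (n + 1))) (ENNReal.ofReal p)).1) hp1
    rw [sub_sub_sub_cancel_left] at h1
    refine (h1.trans (add_le_add (hfast n) (hfast (n + 1)))).trans ?_
    rw [← ENNReal.ofReal_add (by positivity) (by positivity)]
    apply ENNReal.ofReal_le_ofReal
    rw [pow_succ]
    have : (0 : ℝ) ≤ (1 / 4) ^ n := by positivity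
    linarith
  have hθn : ∀ n, eLpNorm (gradient (θ n)) (ENNReal.ofReal p)
      (volume.restrict (Ω : Set (EuclideanSpace ℝ (Fin d)))) ≤
      ENNReal.ofReal (2 * C * (1 / 2) ^ n) := fun n => by
    have h1 : eLpNorm (gradient (θ n)) (ENNReal.ofReal p)
        (volume.restrict (Ω : Set (EuclideanSpace ℝ (Fin d)))) ≤ ENNReal.ofReal (C * 2 ^ n) *
        eLpNorm (fun x => gradient (φ (k (n + 1))) x - gradient (φ (k n)) x)
        (ENNReal.ofReal p) (volume.restrict (Ω : Set (EuclideanSpace ℝ (Fin d)))) := by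
      refine eLpNorm_le_mul_eLpNorm_of_ae_le_mul (Eventually.of_forall fun x => ?_) _
      rw [hθ, gradient_smoothComp, gradient_smul_test, gradient_sub_test, norm_smul, norm_smul,
        mul_assoc, norm_pow, Real.norm_two]
      exact mul_le_mul_of_nonneg_right (hC _) (by positivity)
    refine h1.trans ((mul_le_mul_right (hdiff n) _).trans (le_of_eq ?_))
    rw [← ENNReal.ofReal_mul (by positivity)]
    congr 1
    have : (1 / 4 : ℝ) ^ n = (1 / 2) ^ n * (1 / 2) ^ n := by rw [← mul_pow]; norm_num
    rw [this]
    have : (2 : ℝ) ^ n * (1 / 2) ^ n = 1 := by rw [← mul_pow]; norm_num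
    linear_combination 2 * C * (1 / 2 : ℝ) ^ n * this
  set E : ℕ → Set (EuclideanSpace ℝ (Fin d)) := fun n => {x | 1 < |ψ n x|} with hE
  have hEo : ∀ n, IsOpen (E n) := fun n =>
    isOpen_lt continuous_const (ψ n).continuous.abs
  have hEΩ : ∀ n, E n ⊆ Ω := fun n x hx => by
    by_contra hxΩ
    have : (1 : ℝ) < |ψ n x| := hx
    rw [test_eq_zero_of_notMem (ψ n) hxΩ, abs_zero] at this
    linarith
  set F : ℕ → Set (EuclideanSpace ℝ (Fin d)) := fun m => ⋃ n, E (m + n) with hF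
  have hFcap : ∀ m, capacity p Ω (F m) ≤ ENNReal.ofReal (2 * C * (1 / 2) ^ m * 2) ^ p :=
    fun m => by
    refine (capacity_iUnion_le hd hp hΩ (fun n => isSobolevLimit_const (θ (m + n)))
      (fun n x => hTnn _) (fun n => hEo (m + n)) (fun n => hEΩ (m + n))
      (fun n => ?_)).trans (ENNReal.rpow_le_rpow ?_ hp0.le)
    · filter_upwards [ae_restrict_mem (hEo (m + n)).measurableSet] with x hx
      exact (hT1 _ (le_of_lt hx)).ge
    · rw [← tsum_ofReal_geometric (by positivity)]
      refine ENNReal.tsum_le_tsum fun n => (hθn (m + n)).trans (le_of_eq ?_)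
      rw [pow_add, mul_assoc, mul_assoc, mul_assoc]
  have hFlim : Tendsto (fun m => capacity p Ω (F m)) atTop (𝓝 0) := by
    have h1 : Tendsto (fun m : ℕ => 2 * C * (1 / 2 : ℝ) ^ m * 2) atTop (𝓝 (2 * C * 0 * 2)) :=
      ((tendsto_pow_atTop_nhds_zero_of_lt_one (by norm_num) (by norm_num)).const_mul
        _).mul_const _
    have h2 := (ENNReal.continuous_rpow_const (y := p)).tendsto _ |>.comp
      (ENNReal.tendsto_ofReal h1)
    rw [mul_zero, zero_mul, ENNReal.ofReal_zero, ENNReal.zero_rpow_of_pos hp0] at h2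
    exact tendsto_of_tendsto_of_tendsto_of_le_of_le tendsto_const_nhds h2
      (fun _ => zero_le) hFcap
  -- The value is a default where the sequence diverges, which can happen only on `⋂ m, F m`, a set
  -- of capacity zero.
  set g : EuclideanSpace ℝ (Fin d) → ℝ := fun x => limUnder atTop (fun n => φ (k n) x) with hg
  have hstep : ∀ m x, x ∉ F m → ∀ n,
      dist (φ (k (n + m)) x) (φ (k (n + 1 + m)) x) ≤ (1 / 2) ^ m * (1 / 2) ^ n := by
    intro m x hx n
    have hx' : |ψ (m + n) x| ≤ 1 := by
      by_contra hlt
      exact hx (Set.mem_iUnion.2 ⟨n, not_le.1 hlt⟩)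
    rw [hψa, abs_mul, abs_pow, abs_two] at hx'
    rw [dist_comm, Real.dist_eq, ← pow_add, show n + 1 + m = m + n + 1 by ring,
      add_comm n m, one_div, inv_pow]
    rwa [← one_div, le_div_iff₀' (by positivity)]
  have htend : ∀ m x, x ∉ F m → Tendsto (fun n => φ (k n) x) atTop (𝓝 (g x)) := by
    intro m x hx
    have hc : CauchySeq fun n => φ (k (n + m)) x :=
      cauchySeq_of_le_geometric (1 / 2) ((1 / 2) ^ m) (by norm_num) (hstep m x hx)
    obtain ⟨a, ha⟩ := cauchySeq_tendsto_of_complete hc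
    have ha' : Tendsto (fun n => φ (k n) x) atTop (𝓝 a) := (tendsto_add_atTop_iff_nat m).1 ha
    have : g x = a := ha'.limUnder_eq
    rwa [this]
  -- Off `F m` the increments are geometric, so convergence is uniform there and the limit is
  -- continuous on `Ω \ F m`. Thus `g` is a quasicontinuous representative and equals `u'`
  -- quasi-everywhere.
  have hgq : Quasicontinuous p Ω g := by
    intro ε hε
    obtain ⟨m, hm⟩ := (hFlim.eventually_lt_const hε).exists
    refine ⟨F m, isOpen_iUnion fun n => hEo _, Set.iUnion_subset fun n => hEΩ _, hm, ?_⟩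
    have hunif : TendstoUniformlyOn (fun n x => φ (k (n + m)) x) g atTop
        ((Ω : Set (EuclideanSpace ℝ (Fin d))) \ F m) := by
      rw [Metric.tendstoUniformlyOn_iff]
      intro δ hδ
      have lim : Tendsto (fun n : ℕ => (1 / 2 : ℝ) ^ m * (1 / 2) ^ n / (1 - 1 / 2)) atTop
          (𝓝 ((1 / 2 : ℝ) ^ m * 0 / (1 - 1 / 2))) :=
        ((tendsto_pow_atTop_nhds_zero_of_lt_one (by norm_num) (by norm_num)).const_mul
          _).div_const _
      rw [mul_zero, zero_div] at lim
      filter_upwards [lim.eventually_lt_const hδ] with n hn x hx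
      rw [dist_comm]
      exact (dist_le_of_le_geometric_of_tendsto (1 / 2) ((1 / 2) ^ m) (by norm_num)
        (hstep m x hx.2) ((tendsto_add_atTop_iff_nat m).2 (htend m x hx.2)) n).trans_lt hn
    exact hunif.continuousOn (Eventually.of_forall fun n =>
      (φ (k (n + m))).continuous.continuousOn).frequently
  have hgu : u' =ᵐ[volume.restrict (Ω : Set (EuclideanSpace ℝ (Fin d)))] g := by
    filter_upwards [hae', huu'] with x hx hx'
    rw [hx']
    exact hx.limUnder_eq.symm
  refine ⟨k, hkm, {x | x ∈ Ω ∧ u' x ≠ g x}, ⋂ m, F m, fun x hx => hx.1, ?_,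
    hu'.capacity_ne_eq_zero hp hΩ hgq hgu, ?_, ?_⟩
  · exact (Set.iInter_subset _ 0).trans (Set.iUnion_subset fun n => hEΩ _)
  · refine le_antisymm (ge_of_tendsto' hFlim fun m => capacity_mono (Set.iInter_subset _ m))
      zero_le
  · intro x hx hxA hxB
    have hxg : u' x = g x := by
      by_contra hne
      exact hxA ⟨hx, hne⟩
    simp only [Set.mem_iInter, not_forall] at hxB
    obtain ⟨m, hm⟩ := hxB
    rw [hxg]
    exact htend m x hm

/-! ### Cutoffs and small test functions at sets of capacity zero -/

/-- Smooth cutoff functions. -/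
theorem exists_cutoff {K V : Set (EuclideanSpace ℝ (Fin d))} (hK : IsCompact K) (hV : IsOpen V)
    (hKV : K ⊆ V) (hVΩ : V ⊆ Ω) : ∃ χ : 𝓓(Ω, ℝ), (∀ x, 0 ≤ χ x) ∧ (∀ x, χ x ≤ 1) ∧
      (∀ x ∈ K, χ x = 1) ∧ ∀ x ∉ V, χ x = 0 := by
  obtain ⟨L, hL, hKL, hLV⟩ := exists_compact_between hK hV hKV
  obtain ⟨f, hf, hr, hs, h1⟩ := exists_contMDiff_support_eq_eq_one_iff
    (modelWithCornersSelf ℝ (EuclideanSpace ℝ (Fin d))) (n := (⊤ : ℕ∞)) (isOpen_interior (s := L))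
    hK.isClosed hKL
  have hts : tsupport f ⊆ L := by
    rw [tsupport, hs]
    exact hL.isClosed.closure_subset_iff.2 interior_subset
  refine ⟨⟨f, hf.contDiff, HasCompactSupport.of_support_subset_isCompact hL
    ((subset_tsupport f).trans hts), hts.trans (hLV.trans hVΩ)⟩, fun x => ?_, fun x => ?_,
    fun x hx => (h1 x).1 hx, fun x hx => ?_⟩
  · exact (hr ⟨x, rfl⟩).1
  · exact (hr ⟨x, rfl⟩).2
  · exact image_eq_zero_of_notMem_tsupport fun h => hx (hLV (hts h))

/-- Compact sets of zero capacity carry test functions of arbitrarily small norm. -/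
theorem exists_small_test (hd : 1 ≤ d) (hp : 1 < p)
    (hΩ : Bornology.IsBounded (Ω : Set (EuclideanSpace ℝ (Fin d))))
    {K V : Set (EuclideanSpace ℝ (Fin d))} (hK : IsCompact K) (hV : IsOpen V)
    (hKV : K ⊆ V) (hVΩ : V ⊆ Ω) (hcap : capacity p Ω K = 0) {ε : ℝ} (hε : 0 < ε) :
    ∃ φ : 𝓓(Ω, ℝ), (∀ x, 0 ≤ φ x) ∧ (∀ x, φ x ≤ 1) ∧ (∀ x ∈ K, φ x = 1) ∧ (∀ x ∉ V, φ x = 0) ∧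
      sobolevNorm p Ω φ ≤ ε := by
  set lam := volume.restrict (Ω : Set (EuclideanSpace ℝ (Fin d))) with hlam
  have hp0 : (0 : ℝ) < p := by linarith
  have hp1 := one_le_ofReal hp
  obtain ⟨T, C, hT, hT0, hTnn, hTle, hT1, hC0, hC⟩ := exists_smooth_step
  obtain ⟨CP, hCP, hPC⟩ := exists_poincare hd hp hΩ
  obtain ⟨χ, hχ0, hχ1, hχK, hχV⟩ := exists_cutoff hK hV hKV hVΩ
  obtain ⟨Cχ, hCχ0, hCχ⟩ := gradient_bounded χ
  -- the norm of `χ w` is at most `D` times the norm of `w`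
  set D : ℝ≥0∞ := 1 + ENNReal.ofReal Cχ * CP with hD
  have hDtop : D ≠ ⊤ := ENNReal.add_ne_top.2
    ⟨ENNReal.one_ne_top, ENNReal.mul_ne_top ENNReal.ofReal_ne_top hCP⟩
  have hmul : ∀ w : 𝓓(Ω, ℝ), eLpNorm (gradient (mulTest χ w)) (ENNReal.ofReal p) lam ≤
      D * eLpNorm (gradient w) (ENNReal.ofReal p) lam := fun w => by
    have e : gradient (mulTest χ w) =
        (fun x => χ x • gradient w x) + fun x => w x • gradient χ x := by
      ext1 x; exact gradient_mulTest χ w x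
    rw [e, hD, add_mul, one_mul, mul_assoc]
    refine (eLpNorm_add_le
      (χ.continuous.smul (gradient_continuous w)).aestronglyMeasurable
      (w.continuous.smul (gradient_continuous χ)).aestronglyMeasurable hp1).trans
      (add_le_add ?_ ?_)
    · refine eLpNorm_mono fun x => ?_
      change ‖χ x • gradient w x‖ ≤ _
      rw [norm_smul, Real.norm_eq_abs, abs_of_nonneg (hχ0 x)]
      exact mul_le_of_le_one_left (norm_nonneg _) (hχ1 x)
    · refine (eLpNorm_le_mul_eLpNorm_of_ae_le_mul (g := w) (c := Cχ)
        (Eventually.of_forall fun x => ?_) _).trans (mul_le_mul_right (hPC w) _)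
      change ‖w x • gradient χ x‖ ≤ _
      rw [norm_smul, mul_comm]
      exact mul_le_mul_of_nonneg_right (hCχ x) (norm_nonneg _)
  -- The final norm is at most `D * C * δ` up to errors that vanish as `n → ∞`. The added 1 makes
  -- this strictly less than `ε` and keeps the denominator positive.
  set δ : ℝ := ε / (D.toReal * C + 1) with hδ
  have hDC : 0 < D.toReal * C + 1 := by positivity
  have hδ0 : 0 < δ := by positivity
  obtain ⟨φ, u, G, U, hu, hUo, hKU, hUΩ, hu1, hGδ⟩ := exists_of_capacity_lt (p := p) (Ω := Ω)
    (A := K) (ε := ENNReal.ofReal δ) hp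
    (by rw [hcap]; exact ENNReal.rpow_pos_of_nonneg (ENNReal.ofReal_pos.2 hδ0) hp0.le)
  obtain ⟨η, hη0, hη1, hηK, hηU⟩ := exists_cutoff hK hUo hKU hUΩ
  obtain ⟨Cη, hCη0, hCη⟩ := gradient_bounded η
  set t : ℕ → 𝓓(Ω, ℝ) := fun n => smoothComp (φ n) T hT hT0 with ht
  -- `T(φ_n)` need not equal 1 on `K`, as `φ_n` only approximates `u` in norm. The interpolation `η
  -- + (1 - η) T(φ_n)` is exactly 1 there. Its extra gradient term `(1 - T(φ_n)) ∇η` lives in `U`,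
  -- where `T(u) = 1` almost everywhere, so it is controlled by `|u - φ_n|` and disappears in the
  -- limit.
  set w : ℕ → 𝓓(Ω, ℝ) := fun n => η + (t n - mulTest η (t n)) with hw
  have hwa : ∀ n x, w n x = η x + (1 - η x) * T (φ n x) := fun n x => by
    simp [hw, ht]; ring
  have hlipT : ∀ s r, |T s - T r| ≤ C * |s - r| := fun s r => by
    have := Convex.norm_image_sub_le_of_norm_deriv_le (f := T) (C := C) (s := Set.univ)
      (fun x _ => hT.differentiable (by simp) x) (fun x _ => hC x) convex_univ
      (Set.mem_univ r) (Set.mem_univ s)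
    simpa [Real.norm_eq_abs] using this
  -- Every point outside `U` is a minimum of the nonnegative function `η`.
  have hgηU : ∀ x ∉ U, gradient η x = 0 := fun x hx => by
    have hmin : IsLocalMin η x := Eventually.of_forall fun y => by rw [hηU x hx]; exact hη0 y
    rw [gradient, hmin.fderiv_eq_zero, map_zero]
  have hwg : ∀ n, eLpNorm (gradient (w n)) (ENNReal.ofReal p) lam ≤
      ENNReal.ofReal C * (eLpNorm G (ENNReal.ofReal p) lam +
        eLpNorm (fun x => G x - gradient (φ n) x) (ENNReal.ofReal p) lam) +
      ENNReal.ofReal (Cη * C) * eLpNorm (fun x => u x - φ n x) (ENNReal.ofReal p) lam := by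
    intro n
    have e : gradient (w n) = (fun x => (1 - η x) • gradient (t n) x) +
        fun x => (1 - T (φ n x)) • gradient η x := by
      ext1 x
      rw [hw]
      simp only [gradient_add_test, gradient_sub_test, gradient_mulTest, Pi.add_apply, sub_smul,
        one_smul]
      rw [show t n x = T (φ n x) from rfl]
      abel
    rw [e]
    refine (eLpNorm_add_le
      ((continuous_const.sub η.continuous).smul (gradient_continuous _)).aestronglyMeasurable
      ((continuous_const.sub (hT.continuous.comp (φ n).continuous)).smul
        (gradient_continuous η)).aestronglyMeasurable hp1).trans (add_le_add ?_ ?_)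
    · have h2 := eLpNorm_sub_le hu.memLp_grad.1
        (hu.memLp_grad.1.sub (gradient_memLp (φ n) (ENNReal.ofReal p)).1) hp1
      rw [sub_sub_cancel] at h2
      refine le_trans ?_ (mul_le_mul_right h2 _)
      refine eLpNorm_le_mul_eLpNorm_of_ae_le_mul (Eventually.of_forall fun x => ?_) _
      change ‖(1 - η x) • gradient (smoothComp (φ n) T hT hT0) x‖ ≤ C * ‖gradient (φ n) x‖
      rw [gradient_smoothComp, norm_smul, norm_smul, Real.norm_eq_abs, Real.norm_eq_abs,
        abs_of_nonneg (sub_nonneg.2 (hη1 x))]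
      have := mul_le_mul_of_nonneg_right (hC (φ n x)) (norm_nonneg (gradient (φ n) x))
      refine le_trans (mul_le_of_le_one_left (by positivity) ?_) this
      linarith [hη0 x]
    · refine eLpNorm_le_mul_eLpNorm_of_ae_le_mul ?_ _
      have hu1' : ∀ᵐ x ∂lam, x ∈ U → 1 ≤ u x := by
        have := (ae_restrict_iff' hUo.measurableSet).1 hu1
        exact ae_restrict_of_ae this
      filter_upwards [hu1'] with x hx
      change ‖(1 - T (φ n x)) • gradient η x‖ ≤ _
      rw [norm_smul]
      by_cases hxU : x ∈ U
      · have h1 : T (u x) = 1 := hT1 _ ((hx hxU).trans (le_abs_self _))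
        have h2 := hlipT (u x) (φ n x)
        rw [h1] at h2
        calc ‖1 - T (φ n x)‖ * ‖gradient η x‖ ≤ (C * |u x - φ n x|) * Cη :=
              mul_le_mul h2 (hCη x) (norm_nonneg _) (by positivity)
          _ = _ := by rw [Real.norm_eq_abs]; ring
      · rw [hgηU x hxU, norm_zero, mul_zero]
        positivity
  have hlim := ((ENNReal.Tendsto.const_mul
    (hu.tendsto_grad.const_add (eLpNorm G (ENNReal.ofReal p) lam))
      (Or.inr (ENNReal.ofReal_ne_top (r := C))))).add
    (ENNReal.Tendsto.const_mul hu.tendsto (Or.inr (ENNReal.ofReal_ne_top (r := Cη * C))))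
  rw [add_zero, mul_zero, add_zero] at hlim
  have hlim2 := ENNReal.Tendsto.const_mul hlim (Or.inr hDtop)
  have hlt : D * (ENNReal.ofReal C * eLpNorm G (ENNReal.ofReal p) lam) < ENNReal.ofReal ε := by
    refine lt_of_le_of_lt (mul_le_mul_right (mul_le_mul_right hGδ.le _) _) ?_
    rw [← ENNReal.ofReal_toReal hDtop, ← ENNReal.ofReal_mul hC0,
      ← ENNReal.ofReal_mul ENNReal.toReal_nonneg, ENNReal.ofReal_lt_ofReal_iff hε, hδ,
      ← mul_assoc, ← mul_div_assoc, div_lt_iff₀ hDC]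
    nlinarith
  obtain ⟨n, hn⟩ := (hlim2.eventually_lt_const hlt).exists
  refine ⟨mulTest χ (w n), fun x => ?_, fun x => ?_, fun x hx => ?_, fun x hx => ?_, ?_⟩
  · rw [mulTest_apply, hwa]
    have := hη0 x; have := sub_nonneg.2 (hη1 x); have := hTnn (φ n x); have := hχ0 x
    positivity
  · rw [mulTest_apply, hwa]
    have h1 : η x + (1 - η x) * T (φ n x) ≤ 1 := by
      nlinarith [hTle (φ n x), sub_nonneg.2 (hη1 x)]
    have h2 : 0 ≤ η x + (1 - η x) * T (φ n x) := by
      have := hη0 x; have := sub_nonneg.2 (hη1 x); have := hTnn (φ n x)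
      positivity
    exact mul_le_one₀ (hχ1 x) h2 h1
  · rw [mulTest_apply, hwa, hχK x hx, hηK x hx]; ring
  · rw [mulTest_apply, hχV x hx, zero_mul]
  · rw [sobolevNorm_test hp hΩ]
    refine ENNReal.toReal_le_of_le_ofReal hε.le ?_
    exact ((hmul (w n)).trans (mul_le_mul_right (hwg n) _)).trans hn.le

/-- A decreasing sequence of open neighbourhoods of a compact set, inside a compact subset
of `Ω`. -/
theorem exists_shrinking_nhds {K : Set (EuclideanSpace ℝ (Fin d))} (hK : IsCompact K)
    (hKΩ : K ⊆ Ω) : ∃ (L : Set (EuclideanSpace ℝ (Fin d)))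
      (V : ℕ → Set (EuclideanSpace ℝ (Fin d))), IsCompact L ∧ L ⊆ Ω ∧ (∀ n, IsOpen (V n)) ∧
      (∀ n, K ⊆ V n) ∧ (∀ n, V n ⊆ L) ∧ ∀ x ∉ K, ∀ᶠ n in atTop, x ∉ V n := by
  obtain ⟨L, hL, hKL, hLΩ⟩ := exists_compact_between hK Ω.isOpen hKΩ
  refine ⟨L, fun n => Metric.thickening (1 / ((n : ℝ) + 1)) K ∩ interior L, hL, hLΩ,
    fun n => Metric.isOpen_thickening.inter isOpen_interior,
    fun n => Set.subset_inter (Metric.self_subset_thickening (by positivity) K) hKL,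
    fun n => Set.inter_subset_right.trans interior_subset, fun x hx => ?_⟩
  have hpos : 0 < Metric.infEDist x K := by
    rw [Metric.infEDist_pos_iff_notMem_closure, hK.isClosed.closure_eq]; exact hx
  have lim : Tendsto (fun n : ℕ => ENNReal.ofReal (1 / ((n : ℝ) + 1))) atTop (𝓝 0) := by
    have := ENNReal.tendsto_ofReal (tendsto_one_div_add_atTop_nhds_zero_nat (𝕜 := ℝ))
    rwa [ENNReal.ofReal_zero] at this
  filter_upwards [lim.eventually_lt_const hpos] with n hn hxV
  exact lt_asymm hn (Metric.mem_thickening_iff_infEDist_lt.1 hxV.1)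

/-! ### The two parts vanish on products with sets of capacity zero -/

/-- Two mutually singular measures, finite on the compact subsets of `Ω × Ω`, whose difference has
cut norm at most `C`. -/
structure IsCutPair (p : ℝ) (Ω : Opens (EuclideanSpace ℝ (Fin d)))
    (m₁ m₂ : Measure (EuclideanSpace ℝ (Fin d) × EuclideanSpace ℝ (Fin d))) (C : ℝ) : Prop where
  lt_top_left : ∀ K L : Set (EuclideanSpace ℝ (Fin d)), IsCompact K → IsCompact L → K ⊆ Ω →
    L ⊆ Ω → m₁ (K ×ˢ L) < ⊤
  lt_top_right : ∀ K L : Set (EuclideanSpace ℝ (Fin d)), IsCompact K → IsCompact L → K ⊆ Ω →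
    L ⊆ Ω → m₂ (K ×ˢ L) < ⊤
  mutuallySingular : m₁ ⟂ₘ m₂
  nonneg : 0 ≤ C
  bound : ∀ φ ψ : 𝓓(Ω, ℝ), |∫ z, φ z.1 * ψ z.2 ∂m₁ - ∫ z, φ z.1 * ψ z.2 ∂m₂| ≤
    C * sobolevNorm p Ω φ * sobolevNorm p Ω ψ

section Measures

variable {m₁ m₂ : Measure (EuclideanSpace ℝ (Fin d) × EuclideanSpace ℝ (Fin d))} {C : ℝ}

/-- All conditions on a cut pair are symmetric in the two factors, so results about `N × Ω` transfer
to `Ω × N`. -/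
theorem IsCutPair.swap (h : IsCutPair p Ω m₁ m₂ C) :
    IsCutPair p Ω (m₁.map Prod.swap) (m₂.map Prod.swap) C := by
  have hsw : ∀ (m : Measure (EuclideanSpace ℝ (Fin d) × EuclideanSpace ℝ (Fin d)))
      (s : Set (EuclideanSpace ℝ (Fin d) × EuclideanSpace ℝ (Fin d))),
      m.map Prod.swap s = m (Prod.swap ⁻¹' s) := fun m s =>
    MeasurableEquiv.prodComm.map_apply s
  have hin : ∀ (m : Measure (EuclideanSpace ℝ (Fin d) × EuclideanSpace ℝ (Fin d)))
      (φ ψ : 𝓓(Ω, ℝ)), ∫ z, φ z.1 * ψ z.2 ∂(m.map Prod.swap) = ∫ z, ψ z.1 * φ z.2 ∂m :=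
    fun m φ ψ => by
      rw [show m.map Prod.swap = m.map MeasurableEquiv.prodComm from rfl, integral_map_equiv]
      simp [MeasurableEquiv.prodComm, mul_comm]
  refine ⟨fun K L hK hL hKΩ hLΩ => ?_, fun K L hK hL hKΩ hLΩ => ?_, ?_, h.nonneg, fun φ ψ => ?_⟩
  · rw [hsw, Set.preimage_swap_prod]; exact h.lt_top_left L K hL hK hLΩ hKΩ
  · rw [hsw, Set.preimage_swap_prod]; exact h.lt_top_right L K hL hK hLΩ hKΩ
  · obtain ⟨s, hs, h1, h2⟩ := h.mutuallySingular
    refine ⟨Prod.swap ⁻¹' s, measurable_swap hs, ?_, ?_⟩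
    · rw [hsw]; exact h1
    · rw [hsw]; exact h2
  · rw [hin, hin]
    refine (h.bound ψ φ).trans (le_of_eq ?_)
    ring

/-- Dominated convergence with majorant `M` times the indicator of `S`. It yields integrability of
the limit as well, which supplies the integrability claim of the theorem. -/
theorem tendsto_integral_of_bounded_support {α : Type*} [MeasurableSpace α] {m : Measure α}
    {S : Set α} (hS : MeasurableSet S) (hm : m S < ⊤) {F : ℕ → α → ℝ} {f : α → ℝ} {M : ℝ}
    (hF : ∀ n, AEStronglyMeasurable (F n) m) (hM : ∀ n z, |F n z| ≤ M)
    (h0 : ∀ n, ∀ z ∉ S, F n z = 0) (hlim : ∀ᵐ z ∂m, Tendsto (fun n => F n z) atTop (𝓝 (f z))) :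
    Integrable f m ∧ Tendsto (fun n => ∫ z, F n z ∂m) atTop (𝓝 (∫ z, f z ∂m)) := by
  have hb : Integrable (S.indicator fun _ => M) m :=
    (integrable_indicator_iff hS).2 (integrableOn_const hm.ne)
  have hbound : ∀ n z, ‖F n z‖ ≤ S.indicator (fun _ => M) z := fun n z => by
    by_cases hz : z ∈ S
    · rw [Set.indicator_of_mem hz]; exact hM n z
    · rw [Set.indicator_of_notMem hz, h0 n z hz, norm_zero]
  refine ⟨hb.mono' (aestronglyMeasurable_of_tendsto_ae atTop hF hlim) ?_,
    tendsto_integral_of_dominated_convergence _ hF hb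
      (fun n => Eventually.of_forall (hbound n)) hlim⟩
  filter_upwards [hlim] with z hz
  exact le_of_tendsto' hz.norm fun n => hbound n z

theorem sobolevNorm_nonneg (u : EuclideanSpace ℝ (Fin d) → ℝ) : 0 ≤ sobolevNorm p Ω u := by
  unfold sobolevNorm
  exact Real.rpow_nonneg (integral_nonneg fun x => Real.rpow_nonneg (norm_nonneg _) _) _

/-- The two measures agree on products of a compact set of capacity zero and a compact set. -/
theorem IsCutPair.measure_prod_compact_eq (hd : 1 ≤ d) (hp : 1 < p)
    (hΩ : Bornology.IsBounded (Ω : Set (EuclideanSpace ℝ (Fin d))))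
    (h : IsCutPair p Ω m₁ m₂ C) {K L : Set (EuclideanSpace ℝ (Fin d))} (hK : IsCompact K)
    (hL : IsCompact L) (hKΩ : K ⊆ Ω) (hLΩ : L ⊆ Ω) (hcap : capacity p Ω K = 0) :
    m₁ (K ×ˢ L) = m₂ (K ×ˢ L) := by
  obtain ⟨K', V, hK', hK'Ω, hVo, hKV, hVK', hVlim⟩ := exists_shrinking_nhds hK hKΩ
  obtain ⟨L', W, hL', hL'Ω, hWo, hLW, hWL', hWlim⟩ := exists_shrinking_nhds hL hLΩ
  choose ψ hψ0 hψ1 hψL hψW using fun n =>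
    exists_cutoff hL (hWo n) (hLW n) ((hWL' n).trans hL'Ω)
  -- The norms of the `ψ n` may blow up as the neighbourhoods of `L` shrink, so each `φ n` is chosen
  -- after `ψ n`, small enough for the product of the norms to be at most `1 / (n + 1)`.
  have hpos : ∀ n : ℕ, 0 < 1 / ((n : ℝ) + 1) / (sobolevNorm p Ω (ψ n) + 1) := fun n => by
    have := sobolevNorm_nonneg (p := p) (Ω := Ω) (ψ n)
    positivity
  choose φ hφ0 hφ1 hφK hφV hφn using fun n =>
    exists_small_test hd hp hΩ hK (hVo n) (hKV n) ((hVK' n).trans hK'Ω) hcap (hpos n)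
  have key : ∀ m : Measure (EuclideanSpace ℝ (Fin d) × EuclideanSpace ℝ (Fin d)),
      m (K' ×ˢ L') < ⊤ →
      Tendsto (fun n => ∫ z, φ n z.1 * ψ n z.2 ∂m) atTop (𝓝 (m (K ×ˢ L)).toReal) := by
    intro m hm
    have h1 := (tendsto_integral_of_bounded_support
      (hK'.measurableSet.prod hL'.measurableSet) hm
      (F := fun n z => φ n z.1 * ψ n z.2) (f := (K ×ˢ L).indicator 1) (M := 1) (fun n => ?_)
      (fun n z => ?_) (fun n z hz => ?_) (Eventually.of_forall fun z => ?_)).2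
    · rwa [integral_indicator_one (hK.measurableSet.prod hL.measurableSet)] at h1
    · exact (((φ n).continuous.comp continuous_fst).mul
        ((ψ n).continuous.comp continuous_snd)).aestronglyMeasurable
    · rw [abs_of_nonneg (mul_nonneg (hφ0 n _) (hψ0 n _))]
      exact mul_le_one₀ (hφ1 n _) (hψ0 n _) (hψ1 n _)
    · rw [Set.mem_prod, not_and_or] at hz
      rcases hz with hz | hz
      · rw [hφV n _ fun h => hz (hVK' n h), zero_mul]
      · rw [hψW n _ fun h => hz (hWL' n h), mul_zero]
    · refine tendsto_const_nhds.congr' ?_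
      by_cases hz1 : z.1 ∈ K
      · by_cases hz2 : z.2 ∈ L
        · refine Eventually.of_forall fun n => ?_
          simp only [Set.indicator_of_mem (Set.mem_prod.2 ⟨hz1, hz2⟩), hφK n _ hz1,
            hψL n _ hz2, Pi.one_apply, mul_one]
        · filter_upwards [hWlim _ hz2] with n hn
          rw [Set.indicator_of_notMem fun hz => hz2 hz.2, hψW n _ hn, mul_zero]
      · filter_upwards [hVlim _ hz1] with n hn
        rw [Set.indicator_of_notMem fun hz => hz1 hz.1, hφV n _ hn, zero_mul]
  have hm1 := h.lt_top_left K' L' hK' hL' hK'Ω hL'Ω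
  have hm2 := h.lt_top_right K' L' hK' hL' hK'Ω hL'Ω
  have hdiff := ((key m₁ hm1).sub (key m₂ hm2)).abs
  have hzero : Tendsto (fun n : ℕ => C * (1 / ((n : ℝ) + 1))) atTop (𝓝 0) := by
    have := (tendsto_one_div_add_atTop_nhds_zero_nat (𝕜 := ℝ)).const_mul C
    rwa [mul_zero] at this
  have hle : ∀ n : ℕ, |∫ z, φ n z.1 * ψ n z.2 ∂m₁ - ∫ z, φ n z.1 * ψ n z.2 ∂m₂| ≤
      C * (1 / ((n : ℝ) + 1)) := fun n => by
    refine (h.bound (φ n) (ψ n)).trans ?_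
    have h0 := sobolevNorm_nonneg (p := p) (Ω := Ω) (ψ n)
    rw [mul_assoc]
    refine mul_le_mul_of_nonneg_left ?_ h.nonneg
    have h1 := mul_le_mul_of_nonneg_right (hφn n) h0
    refine h1.trans ?_
    rw [div_mul_eq_mul_div]
    refine div_le_of_le_mul₀ (by positivity) (by positivity) ?_
    refine mul_le_mul_of_nonneg_left (by linarith) (by positivity)
  have hfin := le_antisymm (le_of_tendsto_of_tendsto' hdiff hzero hle) (abs_nonneg _)
  rw [abs_eq_zero, sub_eq_zero] at hfin
  refine (ENNReal.toReal_eq_toReal_iff' ?_ ?_).1 hfin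
  · exact (h.lt_top_left K L hK hL hKΩ hLΩ).ne
  · exact (h.lt_top_right K L hK hL hKΩ hLΩ).ne

theorem measure_eq_of_compact_subsets {ν₁ ν₂ : Measure (EuclideanSpace ℝ (Fin d))}
    [IsFiniteMeasure ν₁] [IsFiniteMeasure ν₂] {s : Set (EuclideanSpace ℝ (Fin d))}
    (hs : MeasurableSet s) (h : ∀ K ⊆ s, IsCompact K → ν₁ K = ν₂ K) : ν₁ s = ν₂ s := by
  rw [hs.measure_eq_iSup_isCompact_of_ne_top (measure_ne_top _ _),
    hs.measure_eq_iSup_isCompact_of_ne_top (measure_ne_top _ _)]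
  exact iSup_congr fun K => iSup_congr fun hK => iSup_congr fun hKc => h K hK hKc

/-- With `t` fixed, `A ↦ m (A ×ˢ t)` is, for `A ⊆ K`, the first marginal of a finite restriction of
`m`. Inner regularity on Euclidean space then reduces Borel sets to compact ones, one factor at a
time. -/
theorem measure_prod_eq_of_compact_left {K t s : Set (EuclideanSpace ℝ (Fin d))}
    (hs : MeasurableSet s) (hsK : s ⊆ K)
    (h1 : m₁ (K ×ˢ t) < ⊤) (h2 : m₂ (K ×ˢ t) < ⊤)
    (h : ∀ A ⊆ s, IsCompact A → m₁ (A ×ˢ t) = m₂ (A ×ˢ t)) : m₁ (s ×ˢ t) = m₂ (s ×ˢ t) := by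
  have e : ∀ (m : Measure (EuclideanSpace ℝ (Fin d) × EuclideanSpace ℝ (Fin d)))
      (A : Set (EuclideanSpace ℝ (Fin d))), A ⊆ K → MeasurableSet A →
      (m.restrict (K ×ˢ t)).map Prod.fst A = m (A ×ˢ t) := fun m A hA hAm => by
    rw [Measure.map_apply measurable_fst hAm, Measure.restrict_apply (measurable_fst hAm)]
    congr 1
    ext z
    simp only [Set.mem_inter_iff, Set.mem_preimage, Set.mem_prod]
    exact ⟨fun h => ⟨h.1, h.2.2⟩, fun h => ⟨h.1, hA h.1, h.2⟩⟩
  have : IsFiniteMeasure (m₁.restrict (K ×ˢ t)) := ⟨by simpa using h1⟩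
  have : IsFiniteMeasure (m₂.restrict (K ×ˢ t)) := ⟨by simpa using h2⟩
  rw [← e m₁ s hsK hs, ← e m₂ s hsK hs]
  refine measure_eq_of_compact_subsets hs fun A hA hAc => ?_
  rw [e m₁ A (hA.trans hsK) hAc.measurableSet, e m₂ A (hA.trans hsK) hAc.measurableSet]
  exact h A hA hAc

theorem measure_prod_eq_of_compact_right {L t s : Set (EuclideanSpace ℝ (Fin d))}
    (ht : MeasurableSet t) (htL : t ⊆ L)
    (h1 : m₁ (s ×ˢ L) < ⊤) (h2 : m₂ (s ×ˢ L) < ⊤)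
    (h : ∀ B ⊆ t, IsCompact B → m₁ (s ×ˢ B) = m₂ (s ×ˢ B)) : m₁ (s ×ˢ t) = m₂ (s ×ˢ t) := by
  have hsw : ∀ (m : Measure (EuclideanSpace ℝ (Fin d) × EuclideanSpace ℝ (Fin d)))
      (A B : Set (EuclideanSpace ℝ (Fin d))), m.map Prod.swap (B ×ˢ A) = m (A ×ˢ B) :=
    fun m A B => by
      rw [← Set.preimage_swap_prod]; exact MeasurableEquiv.prodComm.map_apply _
  have := measure_prod_eq_of_compact_left (m₁ := m₁.map Prod.swap) (m₂ := m₂.map Prod.swap)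
    ht htL (by rwa [hsw]) (by rwa [hsw]) (fun A hA hAc => by
      rw [hsw, hsw]; exact h A hA hAc)
  rwa [hsw, hsw] at this

/-- Compact pieces of `Ω` localize the claim to sets of finite measure. There the two measures agree
on all measurable rectangles, so their restrictions are equal; being also mutually singular, they
are zero. -/
theorem IsCutPair.measure_prod_eq_zero_of_measurableSet (hd : 1 ≤ d) (hp : 1 < p)
    (hΩ : Bornology.IsBounded (Ω : Set (EuclideanSpace ℝ (Fin d))))
    (h : IsCutPair p Ω m₁ m₂ C) {N : Set (EuclideanSpace ℝ (Fin d))} (hN : MeasurableSet N)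
    (hNΩ : N ⊆ Ω) (hcap : capacity p Ω N = 0) :
    (m₁ + m₂) (N ×ˢ (Ω : Set (EuclideanSpace ℝ (Fin d)))) = 0 := by
  obtain ⟨F, hFc, hFΩ, hFU, -⟩ := IsOpen.exists_iUnion_isClosed Ω.isOpen
  have hFcomp : ∀ n, IsCompact (F n) := fun n =>
    Metric.isCompact_of_isClosed_isBounded (hFc n) (hΩ.subset (hFΩ n))
  have hcov : N ×ˢ (Ω : Set (EuclideanSpace ℝ (Fin d))) ⊆ ⋃ n, ⋃ k, (N ∩ F n) ×ˢ F k := by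
    rintro ⟨x, y⟩ ⟨hx, hy⟩
    have hxΩ := hNΩ hx
    rw [← hFU] at hxΩ hy
    obtain ⟨n, hn⟩ := Set.mem_iUnion.1 hxΩ
    obtain ⟨k, hk⟩ := Set.mem_iUnion.1 hy
    exact Set.mem_iUnion.2 ⟨n, Set.mem_iUnion.2 ⟨k, ⟨hx, hn⟩, hk⟩⟩
  refine measure_mono_null hcov (measure_iUnion_null fun n => measure_iUnion_null fun k => ?_)
  set S := (N ∩ F n) ×ˢ F k with hS
  have hl := h.lt_top_left _ _ (hFcomp n) (hFcomp k) (hFΩ n) (hFΩ k)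
  have hr := h.lt_top_right _ _ (hFcomp n) (hFcomp k) (hFΩ n) (hFΩ k)
  have hmn := (hFcomp n).measurableSet
  have hmk := (hFcomp k).measurableSet
  have hSF : S ⊆ F n ×ˢ F k := Set.prod_mono Set.inter_subset_right subset_rfl
  have : IsFiniteMeasure (m₁.restrict S) :=
    ⟨by simpa using (measure_mono hSF).trans_lt hl⟩
  have heq : m₁.restrict S = m₂.restrict S := by
    refine Measure.ext_prod fun {s t} hs ht => ?_
    rw [Measure.restrict_apply (hs.prod ht), Measure.restrict_apply (hs.prod ht), hS,
      Set.prod_inter_prod]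
    have hs' := hs.inter (hN.inter hmn)
    have ht' := ht.inter hmk
    have hsub : s ∩ (N ∩ F n) ⊆ F n := fun x hx => hx.2.2
    refine measure_prod_eq_of_compact_right ht' Set.inter_subset_right
      ((measure_mono (Set.prod_mono hsub subset_rfl)).trans_lt hl)
      ((measure_mono (Set.prod_mono hsub subset_rfl)).trans_lt hr) fun B hB hBc => ?_
    have hBF : B ⊆ F k := hB.trans Set.inter_subset_right
    refine measure_prod_eq_of_compact_left hs' hsub
      ((measure_mono (Set.prod_mono subset_rfl hBF)).trans_lt hl)
      ((measure_mono (Set.prod_mono subset_rfl hBF)).trans_lt hr) fun A hA hAc => ?_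
    exact h.measure_prod_compact_eq hd hp hΩ hAc hBc (hA.trans (hsub.trans (hFΩ n)))
      (hBF.trans (hFΩ k)) (le_antisymm
        ((capacity_mono (hA.trans fun x hx => hx.2.1)).trans hcap.le) zero_le)
  have hsing : m₁.restrict S ⟂ₘ m₂.restrict S :=
    (h.mutuallySingular.mono_ac Measure.absolutelyContinuous_restrict
      Measure.absolutelyContinuous_restrict)
  have h1 : m₁.restrict S = 0 := by
    rw [← heq] at hsing
    exact (Measure.MutuallySingular.self_iff _).1 hsing
  have h2 : m₂.restrict S = 0 := heq ▸ h1
  rw [Measure.coe_add, Pi.add_apply, Measure.restrict_eq_zero.1 h1, Measure.restrict_eq_zero.1 h2,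
    add_zero]

/-- A set of capacity zero is contained in a Borel set of capacity zero. -/
theorem exists_measurable_superset_capacity_zero (hp : 1 < p)
    (hΩ : Bornology.IsBounded (Ω : Set (EuclideanSpace ℝ (Fin d))))
    {A : Set (EuclideanSpace ℝ (Fin d))} (hcap : capacity p Ω A = 0) :
    ∃ N, MeasurableSet N ∧ A ⊆ N ∧ N ⊆ Ω ∧ capacity p Ω N = 0 := by
  have hε : ∀ n : ℕ, capacity p Ω A < ((n : ℝ≥0∞)⁻¹) ^ p := fun n => by
    rw [hcap]; exact ENNReal.rpow_pos_of_nonneg (by simp) (by linarith)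
  choose φ u G U hu hUo hAU hUΩ hu1 hG using fun n => exists_of_capacity_lt hp (hε n)
  refine ⟨⋂ n, U n, MeasurableSet.iInter fun n => (hUo n).measurableSet,
    Set.subset_iInter hAU, (Set.iInter_subset _ 0).trans (hUΩ 0), ?_⟩
  have lim : Tendsto (fun n : ℕ => ((n : ℝ≥0∞)⁻¹) ^ p) atTop (𝓝 0) := by
    have := (ENNReal.continuous_rpow_const (y := p)).tendsto _ |>.comp
      ENNReal.tendsto_inv_nat_nhds_zero
    rwa [ENNReal.zero_rpow_of_pos (by linarith)] at this
  refine le_antisymm (ge_of_tendsto' lim fun n => ?_) zero_le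
  exact (capacity_mono (Set.iInter_subset _ n)).trans
    ((capacity_le hp hΩ (hu n) (hUo n) (hUΩ n) (hu1 n)).trans
      (ENNReal.rpow_le_rpow (hG n).le (by linarith)))

/-- An arbitrary set is enclosed in a Borel one of capacity zero, and the second factor is treated
by `IsCutPair.swap`. -/
theorem IsCutPair.measure_prod_eq_zero (hd : 1 ≤ d) (hp : 1 < p)
    (hΩ : Bornology.IsBounded (Ω : Set (EuclideanSpace ℝ (Fin d))))
    (h : IsCutPair p Ω m₁ m₂ C) {A : Set (EuclideanSpace ℝ (Fin d))}
    (hcap : capacity p Ω A = 0) :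
    (m₁ + m₂) (A ×ˢ (Ω : Set (EuclideanSpace ℝ (Fin d)))) = 0 ∧
    (m₁ + m₂) ((Ω : Set (EuclideanSpace ℝ (Fin d))) ×ˢ A) = 0 := by
  obtain ⟨N, hN, hAN, hNΩ, hNcap⟩ := exists_measurable_superset_capacity_zero hp hΩ hcap
  refine ⟨measure_mono_null (Set.prod_mono hAN subset_rfl)
    (h.measure_prod_eq_zero_of_measurableSet hd hp hΩ hN hNΩ hNcap), ?_⟩
  refine measure_mono_null (Set.prod_mono subset_rfl hAN) ?_
  have := h.swap.measure_prod_eq_zero_of_measurableSet hd hp hΩ hN hNΩ hNcap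
  rw [← Measure.map_add _ _ measurable_swap, ← Set.preimage_swap_prod] at this
  exact (MeasurableEquiv.prodComm.map_apply (μ := m₁ + m₂) _).symm.trans this

end Measures

/-! ### From test functions to quasicontinuous representatives -/

theorem sobolevNorm_smul_test (hp : 1 < p)
    (hΩ : Bornology.IsBounded (Ω : Set (EuclideanSpace ℝ (Fin d)))) (c : ℝ) (φ : 𝓓(Ω, ℝ)) :
    sobolevNorm p Ω (c • φ : 𝓓(Ω, ℝ)) = |c| * sobolevNorm p Ω φ := by
  rw [sobolevNorm_test hp hΩ, sobolevNorm_test hp hΩ]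
  have : gradient (c • φ : 𝓓(Ω, ℝ)) = c • gradient φ := by
    ext1 x; exact gradient_smul_test c φ x
  rw [this, eLpNorm_const_smul, ENNReal.toReal_mul, toReal_enorm, Real.norm_eq_abs]

theorem abs_integral_le_cutNorm (hp : 1 < p)
    (hΩ : Bornology.IsBounded (Ω : Set (EuclideanSpace ℝ (Fin d))))
    {μ : SignedRadonMeasure
      ((Ω : Set (EuclideanSpace ℝ (Fin d))) ×ˢ (Ω : Set (EuclideanSpace ℝ (Fin d))))}
    (hμ : cutNorm p Ω μ < ⊤) (φ ψ : 𝓓(Ω, ℝ)) :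
    |μ.integral fun z => φ z.1 * ψ z.2| ≤
      (cutNorm p Ω μ).toReal * sobolevNorm p Ω φ * sobolevNorm p Ω ψ := by
  -- Normalizing by strict upper bounds `a` and `b` avoids dividing by a norm that could be zero;
  -- afterwards `a` and `b` decrease to the norms.
  have key : ∀ a b : ℝ, 0 < a → 0 < b → sobolevNorm p Ω φ ≤ a → sobolevNorm p Ω ψ ≤ b →
      |μ.integral fun z => φ z.1 * ψ z.2| ≤ (cutNorm p Ω μ).toReal * a * b := by
    intro a b ha hb hφ hψ
    have h1 : sobolevNorm p Ω (a⁻¹ • φ : 𝓓(Ω, ℝ)) ≤ 1 := by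
      rw [sobolevNorm_smul_test hp hΩ, abs_of_pos (inv_pos.2 ha), inv_mul_le_iff₀ ha, mul_one]
      exact hφ
    have h2 : sobolevNorm p Ω (b⁻¹ • ψ : 𝓓(Ω, ℝ)) ≤ 1 := by
      rw [sobolevNorm_smul_test hp hΩ, abs_of_pos (inv_pos.2 hb), inv_mul_le_iff₀ hb, mul_one]
      exact hψ
    have h3 : ENNReal.ofReal |μ.integral fun z => (a⁻¹ • φ : 𝓓(Ω, ℝ)) z.1 *
        (b⁻¹ • ψ : 𝓓(Ω, ℝ)) z.2| ≤ cutNorm p Ω μ :=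
      le_iSup₂_of_le (a⁻¹ • φ) (b⁻¹ • ψ) (le_iSup₂_of_le h1 h2 le_rfl)
    rw [ENNReal.ofReal_le_iff_le_toReal hμ.ne] at h3
    have h4 : (μ.integral fun z => (a⁻¹ • φ : 𝓓(Ω, ℝ)) z.1 * (b⁻¹ • ψ : 𝓓(Ω, ℝ)) z.2) =
        a⁻¹ * b⁻¹ * μ.integral fun z => φ z.1 * ψ z.2 := by
      have e : (fun z : EuclideanSpace ℝ (Fin d) × EuclideanSpace ℝ (Fin d) =>
          (a⁻¹ • φ : 𝓓(Ω, ℝ)) z.1 * (b⁻¹ • ψ : 𝓓(Ω, ℝ)) z.2) =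
          fun z => (a⁻¹ * b⁻¹) * (φ z.1 * ψ z.2) := by
        ext z; simp; ring
      simp only [SignedRadonMeasure.integral]
      rw [e, integral_const_mul, integral_const_mul, mul_sub]
    rw [h4, abs_mul, abs_of_pos (by positivity), ← mul_inv, inv_mul_le_iff₀ (by positivity)] at h3
    linarith
  have lim := tendsto_one_div_add_atTop_nhds_zero_nat (𝕜 := ℝ)
  have lim2 := ((lim.const_add (sobolevNorm p Ω φ)).const_mul (cutNorm p Ω μ).toReal).mul
    (lim.const_add (sobolevNorm p Ω ψ))
  rw [add_zero, add_zero] at lim2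
  refine ge_of_tendsto' lim2 fun n => ?_
  have hn : (0 : ℝ) < 1 / ((n : ℝ) + 1) := by positivity
  have h1 := sobolevNorm_nonneg (p := p) (Ω := Ω) φ
  have h2 := sobolevNorm_nonneg (p := p) (Ω := Ω) ψ
  exact key _ _ (by linarith) (by linarith) (by linarith) (by linarith)

theorem isCutPair_of_cutNorm_lt_top (hp : 1 < p)
    (hΩ : Bornology.IsBounded (Ω : Set (EuclideanSpace ℝ (Fin d))))
    {μ : SignedRadonMeasure
      ((Ω : Set (EuclideanSpace ℝ (Fin d))) ×ˢ (Ω : Set (EuclideanSpace ℝ (Fin d))))}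
    (hμ : cutNorm p Ω μ < ⊤) : IsCutPair p Ω μ.pos μ.neg (cutNorm p Ω μ).toReal where
  lt_top_left _ _ hK hL hKΩ hLΩ := μ.pos_lt_top _ (hK.prod hL) (Set.prod_mono hKΩ hLΩ)
  lt_top_right _ _ hK hL hKΩ hLΩ := μ.neg_lt_top _ (hK.prod hL) (Set.prod_mono hKΩ hLΩ)
  mutuallySingular := μ.mutuallySingular
  nonneg := ENNReal.toReal_nonneg
  bound := abs_integral_le_cutNorm hp hΩ hμ

/-- Bounded compactly supported functions of `W^{1,p}_0` are limits of uniformly bounded test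
functions with supports in a common compact set. -/
theorem exists_bounded_approx (hp : 1 < p)
    {u : EuclideanSpace ℝ (Fin d) → ℝ} (hu : MemW1pZero p Ω u) (hc : HasCompactSupportIn Ω u)
    (hb : MemLp u ⊤ (volume.restrict (Ω : Set (EuclideanSpace ℝ (Fin d))))) :
    ∃ (φ : ℕ → 𝓓(Ω, ℝ)) (G : EuclideanSpace ℝ (Fin d) → EuclideanSpace ℝ (Fin d))
      (L : Set (EuclideanSpace ℝ (Fin d))) (M : ℝ), IsSobolevLimit p Ω φ u G ∧ IsCompact L ∧
      L ⊆ Ω ∧ (∀ n x, |φ n x| ≤ M) ∧ ∀ n, ∀ x ∉ L, φ n x = 0 := by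
  obtain ⟨φ, hφ⟩ := hu.exists_isSobolevLimit
  obtain ⟨K, hK, hKΩ, hK0⟩ := hc
  obtain ⟨L, V, hL, hLΩ, hVo, hKV, hVL, -⟩ := exists_shrinking_nhds hK hKΩ
  obtain ⟨η, -, -, hηK, hηV⟩ := exists_cutoff hK (hVo 0) (hKV 0) ((hVL 0).trans hLΩ)
  -- Truncating at the essential supremum of `|u|` leaves `u` unchanged almost everywhere but bounds
  -- all approximants uniformly. Multiplication by `η`, equal to 1 on `K`, gives them a common
  -- compact support without changing the limit.
  obtain ⟨T, M, hT, hT0, hTid, hTM, hT'⟩ := exists_smooth_truncation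
    (eLpNormEssSup u (volume.restrict (Ω : Set (EuclideanSpace ℝ (Fin d))))).toReal
  obtain ⟨k, -, hlim⟩ := (hφ.mulTest hp η).smoothComp hp hT hT0 hT'
  refine ⟨_, _, L, M, hlim.congr ?_, hL, hLΩ, fun n x => hTM _, fun n x hx => ?_⟩
  · have hbd := ae_le_eLpNormEssSup (f := u)
      (μ := volume.restrict (Ω : Set (EuclideanSpace ℝ (Fin d))))
    have htop := hb.2
    rw [eLpNorm_exponent_top] at htop
    filter_upwards [hK0, hbd] with x hx hxb
    have hxu : η x * u x = u x := by
      by_cases hxK : x ∈ K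
      · rw [hηK x hxK, one_mul]
      · rw [hx hxK, mul_zero]
    rw [hxu]
    refine hTid _ ?_
    have := ENNReal.toReal_mono htop.ne hxb
    rwa [toReal_enorm, Real.norm_eq_abs] at this
  · rw [smoothComp_apply, mulTest_apply, hηV x fun h => hx (hVL 0 h), zero_mul, hT0]

/-- Only an upper bound for the norms of the approximants is needed in the final inequality, and the
triangle inequality supplies one that converges to the right limit. -/
theorem IsSobolevLimit.exists_tendsto_sobolevNorm (hp : 1 < p)
    (hΩ : Bornology.IsBounded (Ω : Set (EuclideanSpace ℝ (Fin d))))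
    {φ : ℕ → 𝓓(Ω, ℝ)} {u : EuclideanSpace ℝ (Fin d) → ℝ}
    {G : EuclideanSpace ℝ (Fin d) → EuclideanSpace ℝ (Fin d)} (h : IsSobolevLimit p Ω φ u G) :
    ∃ a : ℕ → ℝ, (∀ n, sobolevNorm p Ω (φ n) ≤ a n) ∧
      Tendsto a atTop (𝓝 (sobolevNorm p Ω u)) := by
  have hp1 := one_le_ofReal hp
  refine ⟨fun n => (eLpNorm G (ENNReal.ofReal p)
      (volume.restrict (Ω : Set (EuclideanSpace ℝ (Fin d))))).toReal +
      (eLpNorm (fun x => G x - gradient (φ n) x) (ENNReal.ofReal p)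
      (volume.restrict (Ω : Set (EuclideanSpace ℝ (Fin d))))).toReal, fun n => ?_, ?_⟩
  · have hm := h.memLp_grad.sub (gradient_memLp (φ n) (ENNReal.ofReal p))
    have h2 := eLpNorm_sub_le h.memLp_grad.1 hm.1 hp1
    rw [sub_sub_cancel] at h2
    rw [sobolevNorm_test hp hΩ]
    refine (ENNReal.toReal_mono (ENNReal.add_ne_top.2 ⟨h.memLp_grad.2.ne, hm.2.ne⟩) h2).trans ?_
    rw [ENNReal.toReal_add h.memLp_grad.2.ne hm.2.ne]
    exact le_rfl
  · rw [sobolevNorm_eq_of_hasWeakGradient hp (h.hasWeakGradient hp hΩ) h.memLp_grad]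
    have := ((ENNReal.tendsto_toReal ENNReal.zero_ne_top).comp h.tendsto_grad).const_add
      (eLpNorm G (ENNReal.ofReal p)
        (volume.restrict (Ω : Set (EuclideanSpace ℝ (Fin d))))).toReal
    rwa [ENNReal.toReal_zero, add_zero] at this

section Main

variable {μ : SignedRadonMeasure
  ((Ω : Set (EuclideanSpace ℝ (Fin d))) ×ˢ (Ω : Set (EuclideanSpace ℝ (Fin d))))}

theorem ae_notMem_of_capacity_eq_zero (hd : 1 ≤ d) (hp : 1 < p)
    (hΩ : Bornology.IsBounded (Ω : Set (EuclideanSpace ℝ (Fin d))))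
    (hμ : cutNorm p Ω μ < ⊤) {A : Set (EuclideanSpace ℝ (Fin d))} (hA : capacity p Ω A = 0) :
    ∀ᵐ z ∂μ.totalVariation, z.1 ∈ (Ω : Set (EuclideanSpace ℝ (Fin d))) ∧
      z.2 ∈ (Ω : Set (EuclideanSpace ℝ (Fin d))) ∧ z.1 ∉ A ∧ z.2 ∉ A := by
  obtain ⟨h1, h2⟩ := (isCutPair_of_cutNorm_lt_top hp hΩ hμ).measure_prod_eq_zero hd hp hΩ hA
  have h3 : μ.totalVariation ((Ω : Set (EuclideanSpace ℝ (Fin d))) ×ˢ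
      (Ω : Set (EuclideanSpace ℝ (Fin d))))ᶜ = 0 := by
    simp [SignedRadonMeasure.totalVariation, μ.pos_compl, μ.neg_compl]
  filter_upwards [measure_eq_zero_iff_ae_notMem.1 h1, measure_eq_zero_iff_ae_notMem.1 h2,
    measure_eq_zero_iff_ae_notMem.1 h3] with z hz1 hz2 hz3
  have hz : z ∈ (Ω : Set (EuclideanSpace ℝ (Fin d))) ×ˢ
      (Ω : Set (EuclideanSpace ℝ (Fin d))) := not_not.1 hz3
  exact ⟨hz.1, hz.2, fun h => hz1 ⟨h, hz.2⟩, fun h => hz2 ⟨hz.1, h⟩⟩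

/-- The exceptional sets of quasi-everywhere convergence are invisible to `|μ|`, so the uniformly
bounded products of test functions, supported in the fixed compact set `K ×ˢ L`, converge
`|μ|`-almost everywhere. Dominated convergence for `μ⁺`, `μ⁻` and `|μ|` does the rest. -/
theorem integrable_and_abs_integral_le (hd : 1 ≤ d) (hp : 1 < p)
    (hΩ : Bornology.IsBounded (Ω : Set (EuclideanSpace ℝ (Fin d))))
    (hμ : cutNorm p Ω μ < ⊤) {u v u' v' : EuclideanSpace ℝ (Fin d) → ℝ}
    (hu : MemW1pZero p Ω u) (huc : HasCompactSupportIn Ω u)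
    (hub : MemLp u ⊤ (volume.restrict (Ω : Set (EuclideanSpace ℝ (Fin d)))))
    (hv : MemW1pZero p Ω v) (hvc : HasCompactSupportIn Ω v)
    (hvb : MemLp v ⊤ (volume.restrict (Ω : Set (EuclideanSpace ℝ (Fin d)))))
    (hu' : IsQuasicontinuousRep p Ω u u') (hv' : IsQuasicontinuousRep p Ω v v') :
    Integrable (fun z : EuclideanSpace ℝ (Fin d) × EuclideanSpace ℝ (Fin d) =>
      u' z.1 * v' z.2) μ.totalVariation ∧
    |μ.integral fun z => u' z.1 * v' z.2| ≤
      (cutNorm p Ω μ).toReal * sobolevNorm p Ω u * sobolevNorm p Ω v := by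
  obtain ⟨φ, G, K, M, hφ, hK, hKΩ, hφM, hφK⟩ := exists_bounded_approx hp hu huc hub
  obtain ⟨ψ, H, L, N, hψ, hL, hLΩ, hψN, hψL⟩ := exists_bounded_approx hp hv hvc hvb
  obtain ⟨k, hk, A, B, -, -, hA, hB, hklim⟩ :=
    hφ.exists_subseq_quasi_tendsto hd hp hΩ hu'.2.1 hu'.2.2
  obtain ⟨l, hl, A', B', -, -, hA', hB', hllim⟩ :=
    hψ.exists_subseq_quasi_tendsto hd hp hΩ hv'.2.1 hv'.2.2
  have hae : ∀ᵐ z ∂μ.totalVariation, Tendsto (fun n => φ (k n) z.1 * ψ (l n) z.2) atTop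
      (𝓝 (u' z.1 * v' z.2)) := by
    filter_upwards [ae_notMem_of_capacity_eq_zero hd hp hΩ hμ hA,
      ae_notMem_of_capacity_eq_zero hd hp hΩ hμ hB,
      ae_notMem_of_capacity_eq_zero hd hp hΩ hμ hA',
      ae_notMem_of_capacity_eq_zero hd hp hΩ hμ hB'] with z z1 z2 z3 z4
    exact (hklim _ z1.1 z1.2.2.1 z2.2.2.1).mul (hllim _ z1.2.1 z3.2.2.2 z4.2.2.2)
  have hpos := μ.pos_lt_top _ (hK.prod hL) (Set.prod_mono hKΩ hLΩ)
  have hneg := μ.neg_lt_top _ (hK.prod hL) (Set.prod_mono hKΩ hLΩ)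
  have key : ∀ m : Measure (EuclideanSpace ℝ (Fin d) × EuclideanSpace ℝ (Fin d)),
      m (K ×ˢ L) < ⊤ → (∀ᵐ z ∂m, Tendsto (fun n => φ (k n) z.1 * ψ (l n) z.2) atTop
      (𝓝 (u' z.1 * v' z.2))) → Integrable (fun z => u' z.1 * v' z.2) m ∧
      Tendsto (fun n => ∫ z, φ (k n) z.1 * ψ (l n) z.2 ∂m) atTop
        (𝓝 (∫ z, u' z.1 * v' z.2 ∂m)) := by
    intro m hm hlim
    refine tendsto_integral_of_bounded_support (hK.measurableSet.prod hL.measurableSet) hm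
      (M := M * N) (fun n => ?_) (fun n z => ?_) (fun n z hz => ?_) hlim
    · exact (((φ (k n)).continuous.comp continuous_fst).mul
        ((ψ (l n)).continuous.comp continuous_snd)).aestronglyMeasurable
    · rw [abs_mul]
      exact mul_le_mul (hφM _ _) (hψN _ _) (abs_nonneg _) ((abs_nonneg _).trans (hφM 0 0))
    · rw [Set.mem_prod, not_and_or] at hz
      rcases hz with hz | hz
      · rw [hφK _ _ hz, zero_mul]
      · rw [hψL _ _ hz, mul_zero]
  have hae' := ae_add_measure_iff.1 hae
  refine ⟨(key _ (by
    rw [SignedRadonMeasure.totalVariation, Measure.coe_add, Pi.add_apply]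
    exact ENNReal.add_lt_top.2 ⟨hpos, hneg⟩) hae).1, ?_⟩
  obtain ⟨a, ha, halim⟩ := (hφ.comp hk.tendsto_atTop).exists_tendsto_sobolevNorm hp hΩ
  obtain ⟨b, hb, hblim⟩ := (hψ.comp hl.tendsto_atTop).exists_tendsto_sobolevNorm hp hΩ
  refine le_of_tendsto_of_tendsto'
    ((key _ hpos hae'.1).2.sub (key _ hneg hae'.2).2).abs
    ((halim.const_mul (cutNorm p Ω μ).toReal).mul hblim) fun n => ?_
  refine (abs_integral_le_cutNorm hp hΩ hμ (φ (k n)) (ψ (l n))).trans ?_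
  have h1 := sobolevNorm_nonneg (p := p) (Ω := Ω) (φ (k n))
  have h2 := sobolevNorm_nonneg (p := p) (Ω := Ω) (ψ (l n))
  have h3 : (0 : ℝ) ≤ (cutNorm p Ω μ).toReal := ENNReal.toReal_nonneg
  exact mul_le_mul (mul_le_mul_of_nonneg_left (ha n) h3) (hb n) h2
    (mul_nonneg h3 (h1.trans (ha n)))

/-- Two quasicontinuous representatives differ only on a set of capacity zero, so the two integrands
agree `|μ|`-almost everywhere. -/
theorem integral_congr_quasicontinuousRep (hd : 1 ≤ d) (hp : 1 < p)
    (hΩ : Bornology.IsBounded (Ω : Set (EuclideanSpace ℝ (Fin d))))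
    (hμ : cutNorm p Ω μ < ⊤) {u v u₁ u₂ v₁ v₂ : EuclideanSpace ℝ (Fin d) → ℝ}
    (hu₁ : IsQuasicontinuousRep p Ω u u₁) (hu₂ : IsQuasicontinuousRep p Ω u u₂)
    (hv₁ : IsQuasicontinuousRep p Ω v v₁) (hv₂ : IsQuasicontinuousRep p Ω v v₂) :
    (μ.integral fun z => u₁ z.1 * v₁ z.2) = μ.integral fun z => u₂ z.1 * v₂ z.2 := by
  have hA := hu₁.2.1.capacity_ne_eq_zero hp hΩ hu₂.2.1 (hu₁.2.2.trans hu₂.2.2.symm)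
  have hB := hv₁.2.1.capacity_ne_eq_zero hp hΩ hv₂.2.1 (hv₁.2.2.trans hv₂.2.2.symm)
  have hae : ∀ᵐ z ∂μ.totalVariation, u₁ z.1 * v₁ z.2 = u₂ z.1 * v₂ z.2 := by
    filter_upwards [ae_notMem_of_capacity_eq_zero hd hp hΩ hμ hA,
      ae_notMem_of_capacity_eq_zero hd hp hΩ hμ hB] with z z1 z2
    have e1 : u₁ z.1 = u₂ z.1 := by
      by_contra hne
      exact z1.2.2.1 ⟨z1.1, hne⟩
    have e2 : v₁ z.2 = v₂ z.2 := by
      by_contra hne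
      exact z2.2.2.2 ⟨z2.2.1, hne⟩
    rw [e1, e2]
  have hae' := ae_add_measure_iff.1 hae
  simp only [SignedRadonMeasure.integral]
  rw [integral_congr_ae hae'.1, integral_congr_ae hae'.2]

end Main

end SobolevCut

open SobolevCut in
theorem theorem3p3 (d : ℕ) (hd : 1 ≤ d) (p : ℝ) (hp : 1 < p)
    (Ω : Opens (EuclideanSpace ℝ (Fin d)))
    (hΩ : Bornology.IsBounded (Ω : Set (EuclideanSpace ℝ (Fin d))))
    (μ : SignedRadonMeasure
      ((Ω : Set (EuclideanSpace ℝ (Fin d))) ×ˢ (Ω : Set (EuclideanSpace ℝ (Fin d)))))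
    (hμ : cutNorm p Ω μ < ⊤) :
    (∀ A : Set (EuclideanSpace ℝ (Fin d)), A ⊆ Ω → capacity p Ω A = 0 →
      NullMeasurableSet (A ×ˢ (Ω : Set (EuclideanSpace ℝ (Fin d)))) μ.totalVariation ∧
      NullMeasurableSet ((Ω : Set (EuclideanSpace ℝ (Fin d))) ×ˢ A) μ.totalVariation ∧
      μ.totalVariation (A ×ˢ (Ω : Set (EuclideanSpace ℝ (Fin d)))) = 0 ∧
      μ.totalVariation ((Ω : Set (EuclideanSpace ℝ (Fin d))) ×ˢ A) = 0) ∧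
    (∀ u v : EuclideanSpace ℝ (Fin d) → ℝ,
      MemW1pZero p Ω u → HasCompactSupportIn Ω u → MemLp u ⊤ (volume.restrict Ω) →
      MemW1pZero p Ω v → HasCompactSupportIn Ω v → MemLp v ⊤ (volume.restrict Ω) →
      (∀ u' v' : EuclideanSpace ℝ (Fin d) → ℝ,
        IsQuasicontinuousRep p Ω u u' → IsQuasicontinuousRep p Ω v v' →
        Integrable (fun z : EuclideanSpace ℝ (Fin d) × EuclideanSpace ℝ (Fin d) =>
          u' z.1 * v' z.2) μ.totalVariation ∧
        |μ.integral fun z => u' z.1 * v' z.2| ≤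
          (cutNorm p Ω μ).toReal * sobolevNorm p Ω u * sobolevNorm p Ω v) ∧
      (∀ u₁ u₂ v₁ v₂ : EuclideanSpace ℝ (Fin d) → ℝ,
        IsQuasicontinuousRep p Ω u u₁ → IsQuasicontinuousRep p Ω u u₂ →
        IsQuasicontinuousRep p Ω v v₁ → IsQuasicontinuousRep p Ω v v₂ →
        (μ.integral fun z => u₁ z.1 * v₁ z.2) = μ.integral fun z => u₂ z.1 * v₂ z.2)) := by
  have hz : ∀ A : Set (EuclideanSpace ℝ (Fin d)), capacity p Ω A = 0 →
      μ.totalVariation (A ×ˢ (Ω : Set (EuclideanSpace ℝ (Fin d)))) = 0 ∧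
      μ.totalVariation ((Ω : Set (EuclideanSpace ℝ (Fin d))) ×ˢ A) = 0 := fun A hA =>
    (isCutPair_of_cutNorm_lt_top hp hΩ hμ).measure_prod_eq_zero hd hp hΩ hA
  refine ⟨fun A _ hA => ⟨.of_null (hz A hA).1, .of_null (hz A hA).2, hz A hA⟩, ?_⟩
  intro u v hu huc hub hv hvc hvb
  exact ⟨fun u' v' hu' hv' =>
    integrable_and_abs_integral_le hd hp hΩ hμ hu huc hub hv hvc hvb hu' hv',
    fun u₁ u₂ v₁ v₂ hu₁ hu₂ hv₁ hv₂ =>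
      integral_congr_quasicontinuousRep hd hp hΩ hμ hu₁ hu₂ hv₁ hv₂⟩
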